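/- For $0<\kappa\le 1$ let $\mathcal E_\kappa(z)=\sum_{m\ge 0} z^m/\Gamma(\kappa m+1)$ be the Mittag-Leffler function. For $\nu>0$ let $\mathrm{FP}(\nu,\kappa)$ be the law of $\sup\{n\ge 0: T_n\le 1\}$, where $T_n$ is the sum of the first $n$ terms of a sequence of i.i.d. waiting times with distribution function $t\mapsto 1-\mathcal E_\kappa(-\nu t^\kappa)$, $t>0$ (the fractional Poisson law). For $0<\kappa<1$ let $\mathrm{ML}(\kappa)$ be the type 2 Mittag-Leffler law, with density $$f_\kappa(u)=\frac1{\pi\kappa}\sum_{j\ge 1}\frac{(-1)^{j-1}}{j!}\sin(\pi\kappa j)\,\Gamma(\kappa j+1)\,u^{j-1},\qquad u>0,$$ and let $\mathrm{ML}(1)$ be the point mass at $1$. Let $0<\kappa\le 1$, and let $W_1,W_2,\dots$ be i.i.d. random variables whose common law does not depend on $\nu$, with mean $0$ and variance $1$. For every $\nu>0$ let $N=N_\nu\sim \mathrm{FP}(\nu,\kappa)$ be independent of the sequence $(W_n)$. Then: (i) As $\nu\to\infty$, $$\frac1{\sqrt\nu}\sum_{i=1}^{N}W_i\ \xrightarrow{\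 d\ }\ Y,$$ where $Y$ is a random variable with characteristic function $\varphi_Y(s)=\mathcal E_\kappa(-s^2/2)$, $s\in\mathbb R$. (ii) $\mathrm{ML}(\kappa)$ is a probability law, and $Y\overset{d}{=}\sqrt U\,Z$, where $Z\sim N(0,1)$ and $U\sim \mathrm{ML}(\kappa)$ are independent. (The law of $Y$ is called the Normal-Mittag-Leffler law $\mathrm{NML}(\kappa)$.) -/

import Mathlib

open MeasureTheory ProbabilityTheory Filter

noncomputable section

/-- The Mittag-Leffler function `E_κ(z) = ∑_{m ≥ 0} z ^ m / Γ(κ m + 1)` of a real argument. -/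
def mittagLeffler (κ z : ℝ) : ℝ := ∑' m : ℕ, z ^ m / Real.Gamma (κ * m + 1)

/-- `ρ` is the type 1 Mittag-Leffler law with parameters `ν` and `κ`: the probability measure on
the real line with distribution function `t ↦ 1 - E_κ(-ν t ^ κ)` for `t > 0`.
(Letting `t ↓ 0` one sees that such a law gives no mass to `(-∞, 0]`.) -/
structure IsMittagLefflerType1 (ν κ : ℝ) (ρ : Measure ℝ) : Prop where
  isProbabilityMeasure : IsProbabilityMeasure ρ
  cdf_eq : ∀ t : ℝ, 0 < t → cdf ρ t = 1 - mittagLeffler κ (-(ν * t ^ κ))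

/-- The renewal counting function `sup {n ≥ 0 : T_n ≤ t}`, where `T_n` is the sum of the first `n`
waiting times `δ 0, …, δ (n - 1)`. -/
def renewalCount (δ : ℕ → ℝ) (t : ℝ) : ℕ := sSup {n : ℕ | ∑ k ∈ Finset.range n, δ k ≤ t}

theorem renewalCount_eq_succ_iff (δ : ℕ → ℝ) (t : ℝ) (n : ℕ) :
    renewalCount δ t = n + 1 ↔ ∑ k ∈ Finset.range (n + 1), δ k ≤ t ∧
      ∀ m : ℕ, ∑ k ∈ Finset.range m, δ k ≤ t → m ≤ n + 1 := by
  unfold renewalCount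
  set S : Set ℕ := {n : ℕ | ∑ k ∈ Finset.range n, δ k ≤ t} with hS
  constructor
  · intro h
    have hb : BddAbove S := by
      by_contra hb
      rw [Nat.sSup_of_not_bddAbove hb] at h
      omega
    have hne : S.Nonempty := by
      by_contra hne
      rw [Set.not_nonempty_iff_eq_empty] at hne
      rw [hne] at h
      simp at h
    have hmem := Nat.sSup_mem hne hb
    rw [h] at hmem
    exact ⟨hmem, fun m hm => h ▸ le_csSup hb hm⟩
  · rintro ⟨h1, h2⟩
    exact IsGreatest.csSup_eq ⟨h1, fun m hm => h2 m hm⟩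

theorem measurable_renewalCount (t : ℝ) :
    Measurable (fun δ : ℕ → ℝ => renewalCount δ t) := by
  have hs : ∀ n : ℕ, MeasurableSet {δ : ℕ → ℝ | ∑ k ∈ Finset.range n, δ k ≤ t} := fun n =>
    measurableSet_le (by fun_prop) measurable_const
  have hsucc : ∀ n : ℕ, MeasurableSet ((fun δ : ℕ → ℝ => renewalCount δ t) ⁻¹' {n + 1}) := by
    intro n
    have : ((fun δ : ℕ → ℝ => renewalCount δ t) ⁻¹' {n + 1}) =
        {δ : ℕ → ℝ | ∑ k ∈ Finset.range (n + 1), δ k ≤ t} ∩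
          ⋂ m : ℕ, ⋂ _ : ¬ m ≤ n + 1, {δ : ℕ → ℝ | ∑ k ∈ Finset.range m, δ k ≤ t}ᶜ := by
      ext δ
      simp only [Set.mem_preimage, Set.mem_singleton_iff, renewalCount_eq_succ_iff,
        Set.mem_inter_iff, Set.mem_ofPred_eq, Set.mem_iInter, Set.mem_compl_iff]
      exact and_congr_right fun _ => forall_congr' fun m => not_imp_not.symm
    rw [this]
    exact (hs _).inter (MeasurableSet.iInter fun m => MeasurableSet.iInter fun _ => (hs m).compl)
  refine measurable_to_countable' fun n => ?_
  cases n with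
  | zero =>
    have : ((fun δ : ℕ → ℝ => renewalCount δ t) ⁻¹' {0}) =
        (⋃ n : ℕ, (fun δ : ℕ → ℝ => renewalCount δ t) ⁻¹' {n + 1})ᶜ := by
      ext δ
      simp only [Set.mem_preimage, Set.mem_singleton_iff, Set.mem_compl_iff, Set.mem_iUnion,
        not_exists]
      constructor
      · intro h n
        omega
      · intro h
        by_contra h0
        exact h (renewalCount δ t - 1) (by omega)
    rw [this]
    exact (MeasurableSet.iUnion hsucc).compl
  | succ n => exact hsucc n

/-- `m` is the fractional Poisson law `FP(ν, κ)`: the law of the number of arrivals up to time `1`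
of a renewal process whose i.i.d. waiting times have the type 1 Mittag-Leffler law with
parameters `ν` and `κ`. -/
def IsFractionalPoisson (ν κ : ℝ) (m : Measure ℕ) : Prop :=
  ∃ ρ : Measure ℝ, IsMittagLefflerType1 ν κ ρ ∧
    m = (Measure.infinitePi (fun _ : ℕ => ρ)).map (fun δ => renewalCount δ 1)

/-- The density of the type 2 Mittag-Leffler law on `(0, ∞)`, for `0 < κ < 1`:
`f_κ(u) = (1 / (π κ)) ∑_{j ≥ 1} ((-1) ^ (j - 1) / j!) sin(π κ j) Γ(κ j + 1) u ^ (j - 1)`,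
the sum being indexed here by `j - 1`. -/
def mittagLefflerDensity (κ u : ℝ) : ℝ :=
  1 / (Real.pi * κ) * ∑' j : ℕ, (-1) ^ j / (Nat.factorial (j + 1) : ℝ) *
    Real.sin (Real.pi * κ * (j + 1 : ℕ)) * Real.Gamma (κ * (j + 1 : ℕ) + 1) * u ^ j

/-- The type 2 Mittag-Leffler law `ML(κ)`: the law on `(0, ∞)` with density `f_κ` if `0 < κ < 1`,
and the point mass at `1` in the degenerate case `κ = 1`. -/
def mittagLefflerLaw (κ : ℝ) : Measure ℝ :=
  if κ = 1 then Measure.dirac 1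
  else (volume.restrict (Set.Ioi 0)).withDensity
    (fun u => ENNReal.ofReal (mittagLefflerDensity κ u))

/-- The Normal-Mittag-Leffler law `NML(κ)`: the law of `√U * Z` for independent `U ~ ML(κ)` and
`Z ~ N(0, 1)`. -/
def normalMittagLefflerLaw (κ : ℝ) : Measure ℝ :=
  ((mittagLefflerLaw κ).prod (gaussianReal 0 1)).map (fun p => √p.1 * p.2)

end

noncomputable section

/-! ### The Mittag-Leffler function -/

/-! Everything rests on the generating function E[z^N] = E_κ(-ν(1-z)). The waiting times have
Laplace transform ν/(ν+σ^κ), so the discounted renewal measure ∑ z^n law(T_{n+1}) has transform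
ν/(ν(1-z)+σ^κ). This is 1/(1-z) times the transform of the waiting time law of rate ν(1-z), and
comparing the two measures on (-∞, 1] gives the formula (`IsFractionalPoisson.integral_pow`).

With z = e^{-l/ν}, the Laplace transform of N/ν tends to E_κ(-l). Tightness then produces a law Q
with this Laplace transform (`exists_laplace_eq_mittagLeffler`). For κ < 1, Q is identified with
ML(κ) through Mellin transforms: for 0 < s < 1 the moment of order -s is Γ(1-s)/Γ(1-κs) on both
sides. For Q this follows from the two Laplace transforms; for the density it follows from an
integral along a rotated ray and the reflection formula. The sign of f_κ is not known beforehand,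
and `eq_mittagLefflerLaw_of_lintegral_rpow` obtains it from the same comparison. The characteristic
function of √U Z at s is the Laplace transform of U at s²/2, hence E_κ(-s²/2).

Conditioning on N, the random sum has characteristic function E[φ_w(s/√ν)^N]. For Gaussian summands
this is exactly the Laplace transform of N/ν at s²/2. Other summands change each factor by o(1/ν),
and the total error is at most 3(1 - E[e^{-εN/ν}]), whose limit 3(1 - E_κ(-ε)) is small with ε.
Lévy's continuity theorem concludes. -/

theorem rpow_mul_exp_neg_le_Gamma_add_one {y R : ℝ} (hy : 0 ≤ y) (hR : 0 < R) :
    R ^ y * Real.exp (-R) ≤ Real.Gamma (y + 1) := by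
  have hint : IntegrableOn (fun x : ℝ => Real.exp (-x) * x ^ (y + 1 - 1)) (Set.Ioi 0) :=
    Real.GammaIntegral_convergent (by linarith)
  rw [Real.Gamma_eq_integral (by linarith)]
  have hsub : Set.Ioi R ⊆ Set.Ioi (0 : ℝ) := Set.Ioi_subset_Ioi hR.le
  have hexp : IntegrableOn (fun x : ℝ => R ^ y * Real.exp (-x)) (Set.Ioi R) :=
    (integrableOn_exp_neg_Ioi R).const_mul _
  -- Only the part of Euler's integral beyond `R` is kept, where x^y ≥ R^y.
  calc R ^ y * Real.exp (-R) = ∫ x in Set.Ioi R, R ^ y * Real.exp (-x) := by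
        rw [integral_const_mul, integral_exp_neg_Ioi]
    _ ≤ ∫ x in Set.Ioi R, Real.exp (-x) * x ^ (y + 1 - 1) := by
        refine setIntegral_mono_on hexp (hint.mono_set hsub) measurableSet_Ioi fun x hx => ?_
        rw [mul_comm, add_sub_cancel_right]
        gcongr
        exact (Set.mem_Ioi.1 hx).le
    _ ≤ ∫ x in Set.Ioi 0, Real.exp (-x) * x ^ (y + 1 - 1) := by
        refine setIntegral_mono_set hint ?_ hsub.eventuallyLE
        filter_upwards [ae_restrict_mem measurableSet_Ioi] with x hx
        have : 0 < x := hx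
        positivity

theorem Gamma_mul_add_one_pos {κ : ℝ} (hκ : 0 < κ) (m : ℕ) : 0 < Real.Gamma (κ * m + 1) :=
  Real.Gamma_pos_of_pos (by positivity)

theorem summable_pow_div_Gamma {κ : ℝ} (hκ : 0 < κ) (z : ℝ) :
    Summable fun m : ℕ => z ^ m / Real.Gamma (κ * m + 1) := by
  -- Chosen so that R^κ = 2(|z|+1): the Gamma bound then beats |z|^m by a factor 2^{-m}.
  set R : ℝ := (2 * (|z| + 1)) ^ κ⁻¹ with hRdef
  have hz : 0 < |z| + 1 := by positivity
  have hR : 0 < R := by positivity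
  have hRκ : R ^ κ = 2 * (|z| + 1) := Real.rpow_inv_rpow (by positivity) hκ.ne'
  refine Summable.of_norm_bounded (g := fun m : ℕ => Real.exp R * (1 / 2 : ℝ) ^ m)
    ((summable_geometric_of_lt_one (by norm_num) (by norm_num)).mul_left _) fun m => ?_
  rw [norm_div, norm_pow, Real.norm_eq_abs, Real.norm_of_nonneg (Gamma_mul_add_one_pos hκ m).le,
    div_le_iff₀ (Gamma_mul_add_one_pos hκ m)]
  have h := rpow_mul_exp_neg_le_Gamma_add_one (y := κ * m) (by positivity) hR
  rw [Real.rpow_mul hR.le, hRκ, Real.rpow_natCast] at h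
  calc |z| ^ m ≤ (|z| + 1) ^ m := by gcongr; linarith
    _ = Real.exp R * (1 / 2) ^ m * ((2 * (|z| + 1)) ^ m * Real.exp (-R)) := by
        rw [mul_pow, Real.exp_neg]
        field_simp
        rw [← mul_pow]; norm_num
    _ ≤ _ := by gcongr

theorem mittagLeffler_zero (κ : ℝ) : mittagLeffler κ 0 = 1 := by
  rw [mittagLeffler, tsum_eq_single 0]
  · simp
  · intro m hm
    simp [hm]

theorem mittagLeffler_one (z : ℝ) : mittagLeffler 1 z = Real.exp z := by
  rw [mittagLeffler, Real.exp_eq_exp_ℝ, NormedSpace.exp_eq_tsum_div]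
  simp [Real.Gamma_nat_eq_factorial]

theorem continuous_mittagLeffler {κ : ℝ} (hκ : 0 < κ) : Continuous (mittagLeffler κ) := by
  rw [continuous_iff_continuousAt]
  intro z
  have h : ContinuousOn (mittagLeffler κ) (Metric.ball 0 (|z| + 1)) := by
    refine continuousOn_tsum (u := fun m : ℕ => (|z| + 1) ^ m / Real.Gamma (κ * m + 1))
      (fun m => by fun_prop) (summable_pow_div_Gamma hκ _) fun m x hx => ?_
    rw [norm_div, norm_pow, Real.norm_of_nonneg (Gamma_mul_add_one_pos hκ m).le]
    have : ‖x‖ ≤ |z| + 1 := by simpa using (mem_ball_zero_iff.1 hx).le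
    have := Gamma_mul_add_one_pos hκ m
    gcongr
  exact h.continuousAt (Metric.isOpen_ball.mem_nhds (by simp))

/-! ### Uniqueness of two-sided Laplace transforms -/

/-- Identity theorem: the real points near `t` accumulate at `t`. It carries formulas from the real
axis to a complex domain. -/
theorem eqOn_of_eventually_eq_ofReal {U : Set ℂ} (hU : IsPreconnected U) {f g : ℂ → ℂ}
    (hf : AnalyticOnNhd ℂ f U) (hg : AnalyticOnNhd ℂ g U) {t : ℝ} (ht : (t : ℂ) ∈ U)
    (hfg : ∀ᶠ x : ℝ in nhds t, f x = g x) : Set.EqOn f g U := by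
  refine hf.eqOn_of_preconnected_of_frequently_eq hg hU ht ?_
  have h_real : ∃ᶠ x : ℝ in nhdsWithin t {t}ᶜ, f x = g x :=
    (hfg.filter_mono nhdsWithin_le_nhds).frequently
  have hmap : Tendsto (fun x : ℝ => (x : ℂ)) (nhdsWithin t {t}ᶜ)
      (nhdsWithin (t : ℂ) {(t : ℂ)}ᶜ) := by
    refine tendsto_nhdsWithin_iff.2 ⟨?_, ?_⟩
    · exact (Complex.continuous_ofReal.tendsto t).mono_left nhdsWithin_le_nhds
    · filter_upwards [self_mem_nhdsWithin] with x hx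
      simpa using hx
  exact hmap.frequently h_real

theorem Ioo_subset_interior_integrableExpSet {μ : Measure ℝ} {a b : ℝ}
    (h : ∀ t ∈ Set.Ioo a b, Integrable (fun x => Real.exp (t * x)) μ) :
    Set.Ioo a b ⊆ interior (integrableExpSet id μ) :=
  interior_maximal (fun t ht => h t ht) isOpen_Ioo

theorem isPreconnected_re_preimage_Ioo (a b : ℝ) :
    IsPreconnected {z : ℂ | z.re ∈ Set.Ioo a b} :=
  ((convex_Ioo a b).linear_preimage Complex.reLm).isPreconnected

theorem isFiniteMeasure_withDensity_exp {μ : Measure ℝ} {c : ℝ}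
    (h : Integrable (fun x => Real.exp (c * x)) μ) :
    IsFiniteMeasure (μ.withDensity fun x => ENNReal.ofReal (Real.exp (c * x))) :=
  isFiniteMeasure_withDensity_ofReal h.2

/-- Tilting by e^{cx} turns the transform on the vertical line Re z = c into a characteristic
function, to which Fourier uniqueness applies. -/
theorem charFun_withDensity_exp (μ : Measure ℝ) (c s : ℝ) :
    charFun (μ.withDensity fun x => ENNReal.ofReal (Real.exp (c * x))) s =
      complexMGF id μ (c + s * Complex.I) := by
  rw [charFun_apply_real, integral_withDensity_eq_integral_toReal_smul (by fun_prop) (by simp),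
    complexMGF]
  congr with x
  rw [ENNReal.toReal_ofReal (Real.exp_pos _).le, Complex.real_smul, Complex.ofReal_exp,
    ← Complex.exp_add]
  congr 1
  push_cast [id]
  ring

theorem withDensity_exp_injective {μ μ' : Measure ℝ} (c : ℝ)
    (h : μ.withDensity (fun x => ENNReal.ofReal (Real.exp (c * x))) =
      μ'.withDensity fun x => ENNReal.ofReal (Real.exp (c * x))) : μ = μ' := by
  have key (ρ : Measure ℝ) := withDensity_inv_same (μ := ρ)
    (f := fun x => ENNReal.ofReal (Real.exp (c * x))) (by fun_prop)
    (.of_forall fun x => by simp [Real.exp_pos]) (.of_forall fun x => ENNReal.ofReal_ne_top)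
  rw [← key μ, h, key μ']

/-- Two measures on the real line with finite and equal moment generating functions on a nonempty
open interval are equal. -/
theorem MeasureTheory.Measure.ext_of_mgf_eqOn_Ioo {μ μ' : Measure ℝ} {a b : ℝ} (hab : a < b)
    (h : ∀ t ∈ Set.Ioo a b, Integrable (fun x => Real.exp (t * x)) μ)
    (h' : ∀ t ∈ Set.Ioo a b, Integrable (fun x => Real.exp (t * x)) μ')
    (heq : ∀ t ∈ Set.Ioo a b, ∫ x, Real.exp (t * x) ∂μ = ∫ x, Real.exp (t * x) ∂μ') :
    μ = μ' := by
  obtain ⟨c, hc⟩ : (Set.Ioo a b).Nonempty := Set.nonempty_Ioo.2 hab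
  have han {ρ : Measure ℝ} (hρ : ∀ t ∈ Set.Ioo a b, Integrable (fun x => Real.exp (t * x)) ρ) :
      AnalyticOnNhd ℂ (complexMGF id ρ) {z | z.re ∈ Set.Ioo a b} :=
    analyticOnNhd_complexMGF.mono fun z hz => Ioo_subset_interior_integrableExpSet hρ hz
  -- Agreement on the real interval spreads to the whole strip above it, in particular to the line
  -- Re z = c.
  have hE := eqOn_of_eventually_eq_ofReal (isPreconnected_re_preimage_Ioo a b) (han h) (han h')
    (t := c) (by simpa using hc) (by
      filter_upwards [isOpen_Ioo.mem_nhds hc] with x hx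
      rw [complexMGF_ofReal, complexMGF_ofReal]
      exact congrArg _ (heq x hx))
  have := isFiniteMeasure_withDensity_exp (h c hc)
  have := isFiniteMeasure_withDensity_exp (h' c hc)
  refine withDensity_exp_injective c (Measure.ext_of_charFun ?_)
  ext s
  rw [charFun_withDensity_exp, charFun_withDensity_exp]
  exact hE (by simpa using hc)

/-- With values in [0, ∞], finiteness of one transform passes to the other, so no integrability has
to be checked for `μ'`. -/
theorem MeasureTheory.Measure.ext_of_lintegral_exp_eqOn_Ioo {μ μ' : Measure ℝ} {a b : ℝ}
    (hab : a < b)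
    (h : ∀ t ∈ Set.Ioo a b, ∫⁻ x, ENNReal.ofReal (Real.exp (t * x)) ∂μ ≠ ⊤)
    (heq : ∀ t ∈ Set.Ioo a b, ∫⁻ x, ENNReal.ofReal (Real.exp (t * x)) ∂μ =
      ∫⁻ x, ENNReal.ofReal (Real.exp (t * x)) ∂μ') :
    μ = μ' := by
  have hint {ρ : Measure ℝ} {t : ℝ} (ht : ∫⁻ x, ENNReal.ofReal (Real.exp (t * x)) ∂ρ ≠ ⊤) :
      Integrable (fun x => Real.exp (t * x)) ρ :=
    (lintegral_ofReal_ne_top_iff_integrable (by fun_prop)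
      (.of_forall fun x => (Real.exp_pos _).le)).1 ht
  refine Measure.ext_of_mgf_eqOn_Ioo hab (fun t ht => hint (h t ht))
    (fun t ht => hint (heq t ht ▸ h t ht)) fun t ht => ?_
  rw [integral_eq_lintegral_of_nonneg_ae (.of_forall fun x => (Real.exp_pos _).le) (by fun_prop),
    integral_eq_lintegral_of_nonneg_ae (.of_forall fun x => (Real.exp_pos _).le) (by fun_prop),
    heq t ht]

/-! ### The Laplace transform of the type 1 Mittag-Leffler law -/

theorem integrableOn_rpow_mul_exp_neg {p c : ℝ} (hp : 0 < p) (hc : 0 < c) :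
    IntegrableOn (fun t : ℝ => t ^ (p - 1) * Real.exp (-(c * t))) (Set.Ioi 0) := by
  refine Integrable.of_integral_ne_zero ?_
  rw [Real.integral_rpow_mul_exp_neg_mul_Ioi hp hc]
  have := Real.Gamma_pos_of_pos hp
  positivity

/-- The series is integrated term by term. The norms sum to a geometric series of ratio ν/σ^κ, hence
the restriction on `σ`; analytic continuation removes it later. -/
theorem integral_exp_neg_mul_mittagLeffler_of_lt {κ ν σ : ℝ} (hκ : 0 < κ) (hν : 0 < ν)
    (hσ : 0 < σ) (hlt : ν < σ ^ κ) :
    ∫ t in Set.Ioi (0 : ℝ), Real.exp (-(σ * t)) * mittagLeffler κ (-(ν * t ^ κ)) =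
      σ⁻¹ * (σ ^ κ / (ν + σ ^ κ)) := by
  have hσκ : 0 < σ ^ κ := by positivity
  set F : ℕ → ℝ → ℝ := fun m t =>
    Real.exp (-(σ * t)) * ((-(ν * t ^ κ)) ^ m / Real.Gamma (κ * m + 1)) with hF
  have hF' (m : ℕ) : Set.EqOn (F m) (fun t => ((-ν) ^ m / Real.Gamma (κ * m + 1)) *
      (t ^ (κ * m + 1 - 1) * Real.exp (-(σ * t)))) (Set.Ioi 0) := by
    intro t ht
    have ht0 : (0 : ℝ) ≤ t := (Set.mem_Ioi.1 ht).le
    simp only [hF, add_sub_cancel_right]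
    rw [Real.rpow_mul ht0, Real.rpow_natCast, ← neg_mul ν, mul_pow]
    ring
  have hnorm (m : ℕ) : Set.EqOn (fun t => ‖F m t‖) (fun t => (ν ^ m / Real.Gamma (κ * m + 1)) *
      (t ^ (κ * m + 1 - 1) * Real.exp (-(σ * t)))) (Set.Ioi 0) := by
    intro t ht
    have ht0 : (0 : ℝ) < t := ht
    have := Gamma_mul_add_one_pos hκ m
    change ‖F m t‖ = _
    rw [hF' m ht, norm_mul, norm_div, norm_pow, norm_neg, Real.norm_of_nonneg hν.le,
      Real.norm_of_nonneg this.le, Real.norm_of_nonneg (by positivity)]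
  have hbase (m : ℕ) (c : ℝ) : ∫ t in Set.Ioi (0 : ℝ), (c / Real.Gamma (κ * m + 1)) *
      (t ^ (κ * m + 1 - 1) * Real.exp (-(σ * t))) = σ⁻¹ * (c / (σ ^ κ) ^ m) := by
    have hG := Gamma_mul_add_one_pos hκ m
    rw [integral_const_mul, Real.integral_rpow_mul_exp_neg_mul_Ioi (by positivity) hσ,
      one_div, Real.inv_rpow hσ.le, Real.rpow_add hσ, Real.rpow_one, Real.rpow_mul hσ.le,
      Real.rpow_natCast]
    field_simp
  have hint (m : ℕ) : IntegrableOn (F m) (Set.Ioi 0) := by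
    rw [integrableOn_congr_fun (hF' m) measurableSet_Ioi]
    exact (integrableOn_rpow_mul_exp_neg (by positivity) hσ).const_mul _
  have hsum : Summable fun m => ∫ t in Set.Ioi 0, ‖F m t‖ := by
    have : (fun m => ∫ t in Set.Ioi 0, ‖F m t‖) = fun m => σ⁻¹ * (ν / σ ^ κ) ^ m := by
      ext m
      rw [setIntegral_congr_fun measurableSet_Ioi (hnorm m), hbase, div_pow]
    rw [this]
    exact (summable_geometric_of_lt_one (by positivity) ((div_lt_one hσκ).2 hlt)).mul_left _
  have h := hasSum_integral_of_summable_integral_norm hint hsum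
  have hterm (m : ℕ) : ∫ t in Set.Ioi 0, F m t = σ⁻¹ * (-ν / σ ^ κ) ^ m := by
    rw [setIntegral_congr_fun measurableSet_Ioi (hF' m), hbase, div_pow]
  simp only [hterm] at h
  have habs : |-ν / σ ^ κ| < 1 := by
    rwa [abs_div, abs_neg, abs_of_pos hν, abs_of_pos hσκ, div_lt_one hσκ]
  have h2 := (hasSum_geometric_of_abs_lt_one habs).mul_left σ⁻¹
  have h3 : ∫ t in Set.Ioi (0 : ℝ), Real.exp (-(σ * t)) * mittagLeffler κ (-(ν * t ^ κ)) =
      ∫ t in Set.Ioi (0 : ℝ), ∑' m, F m t := by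
    congr with t
    rw [mittagLeffler, ← tsum_mul_left]
  have hne : ν + σ ^ κ ≠ 0 := by positivity
  have hne' : 1 - -ν / σ ^ κ ≠ 0 := by
    rw [neg_div, sub_neg_eq_add]
    positivity
  rw [h3, h.unique h2]
  congr 1
  rw [inv_eq_iff_eq_inv, inv_div]
  field_simp
  ring

/-- Integration by parts for the Laplace transform of a law on `(0, ∞)`. -/
theorem integral_exp_neg_mul_measureReal_Ioi {ρ : Measure ℝ} [IsProbabilityMeasure ρ]
    (hρ : ∀ᵐ x ∂ρ, 0 < x) {σ : ℝ} (hσ : 0 < σ) :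
    ∫ t in Set.Ioi (0 : ℝ), Real.exp (-(σ * t)) * ρ.real (Set.Ioi t) =
      σ⁻¹ * (1 - ∫ x, Real.exp (-(σ * x)) ∂ρ) := by
  -- The integration by parts is Fubini for e^{-σt} on the region 0 < t < x.
  set f : ℝ → ℝ → ℝ := fun t x => Real.exp (-(σ * t)) * (Set.Ioi t).indicator 1 x with hf
  have hbound : Integrable (fun p : ℝ × ℝ => Real.exp (-(σ * p.1)))
      ((volume.restrict (Set.Ioi 0)).prod ρ) := by
    have : Integrable (fun t : ℝ => Real.exp (-(σ * t))) (volume.restrict (Set.Ioi 0)) := by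
      have := integrableOn_exp_mul_Ioi (neg_lt_zero.2 hσ) 0
      simp only [neg_mul] at this
      exact this
    exact this.comp_fst ρ
  have hmeas : Measurable (Function.uncurry f) := by
    have : Function.uncurry f = fun p : ℝ × ℝ =>
        Real.exp (-(σ * p.1)) * {q : ℝ × ℝ | q.1 < q.2}.indicator 1 p := by
      ext ⟨t, x⟩
      simp [f, Function.uncurry, Set.indicator_apply]
    rw [this]
    exact (by fun_prop : Measurable fun p : ℝ × ℝ => Real.exp (-(σ * p.1))).mul
      (measurable_one.indicator (measurableSet_lt measurable_fst measurable_snd))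
  have hint : Integrable (Function.uncurry f) ((volume.restrict (Set.Ioi 0)).prod ρ) := by
    refine hbound.mono hmeas.aestronglyMeasurable (.of_forall fun ⟨t, x⟩ => ?_)
    simp only [Function.uncurry, f, norm_mul]
    refine mul_le_of_le_one_right (norm_nonneg _) ?_
    by_cases hx : x ∈ Set.Ioi t <;> simp [hx]
  have hleft : ∀ t : ℝ, ∫ x, f t x ∂ρ = Real.exp (-(σ * t)) * ρ.real (Set.Ioi t) := by
    intro t
    rw [integral_const_mul, integral_indicator_one measurableSet_Ioi]
  have hright : ∀ x : ℝ, 0 < x →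
      ∫ t in Set.Ioi (0 : ℝ), f t x = σ⁻¹ * (1 - Real.exp (-(σ * x))) := by
    intro x hx
    have h1 : ∀ t : ℝ, f t x = (Set.Iio x).indicator (fun t => Real.exp (-(σ * t))) t := by
      intro t
      simp [f, Set.indicator_apply]
    simp only [h1]
    rw [integral_indicator measurableSet_Iio, Measure.restrict_restrict measurableSet_Iio,
      Set.inter_comm, Set.Ioi_inter_Iio, ← integral_Ioc_eq_integral_Ioo,
      ← intervalIntegral.integral_of_le hx.le]
    have hd : ∀ t ∈ Set.uIcc 0 x, HasDerivAt (fun t => -σ⁻¹ * Real.exp (-(σ * t)))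
        (Real.exp (-(σ * t))) t := fun t _ => by
      have h2 : HasDerivAt (fun t : ℝ => -(σ * t)) (-(σ * 1)) t :=
        ((hasDerivAt_id' t).const_mul σ).neg
      have h3 := h2.exp.const_mul (-σ⁻¹)
      convert! h3 using 1
      field_simp
    rw [intervalIntegral.integral_eq_sub_of_hasDerivAt hd
      (Continuous.intervalIntegrable (by fun_prop) _ _)]
    simp
    ring
  calc _ = ∫ t in Set.Ioi (0 : ℝ), ∫ x, f t x ∂ρ := by simp only [hleft]
    _ = ∫ x, (∫ t in Set.Ioi (0 : ℝ), f t x) ∂ρ := integral_integral_swap hint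
    _ = ∫ x, σ⁻¹ * (1 - Real.exp (-(σ * x))) ∂ρ := by
        refine integral_congr_ae ?_
        filter_upwards [hρ] with x hx using hright x hx
    _ = _ := by
        have hi : Integrable (fun x => Real.exp (-(σ * x))) ρ := by
          refine Integrable.of_bound (by fun_prop) 1 ?_
          filter_upwards [hρ] with x hx
          rw [Real.norm_of_nonneg (Real.exp_pos _).le, Real.exp_le_one_iff]
          nlinarith
        rw [integral_const_mul, integral_sub (integrable_const _) hi]
        simp

namespace IsMittagLefflerType1

variable {ν κ : ℝ} {ρ : Measure ℝ}

theorem measureReal_Ioi (h : IsMittagLefflerType1 ν κ ρ) {t : ℝ} (ht : 0 < t) :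
    ρ.real (Set.Ioi t) = mittagLeffler κ (-(ν * t ^ κ)) := by
  have := h.isProbabilityMeasure
  rw [← Set.compl_Iic, probReal_compl_eq_one_sub measurableSet_Iic, ← cdf_eq_real, h.cdf_eq t ht]
  ring

/-- Since E_κ is continuous with value 1 at 0, the distribution function tends to 0 as t ↓ 0; by
monotonicity it vanishes at 0. -/
theorem ae_pos (h : IsMittagLefflerType1 ν κ ρ) (hκ : 0 < κ) : ∀ᵐ x ∂ρ, 0 < x := by
  have := h.isProbabilityMeasure
  have hlim : Tendsto (fun t : ℝ => 1 - mittagLeffler κ (-(ν * t ^ κ))) (nhdsWithin 0 (Set.Ioi 0))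
      (nhds 0) := by
    have hc : Continuous fun t : ℝ => 1 - mittagLeffler κ (-(ν * t ^ κ)) :=
      continuous_const.sub ((continuous_mittagLeffler hκ).comp
        (continuous_const.mul (Real.continuous_rpow_const hκ.le)).neg)
    have := (hc.tendsto 0).mono_left (nhdsWithin_le_nhds (s := Set.Ioi 0))
    simpa [Real.zero_rpow hκ.ne', mittagLeffler_zero] using this
  have h0 : cdf ρ 0 ≤ 0 := by
    refine ge_of_tendsto hlim ?_
    filter_upwards [self_mem_nhdsWithin] with t ht
    rw [← h.cdf_eq t ht]
    exact monotone_cdf ρ (Set.mem_Ioi.1 ht).le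
  have h1 : ρ (Set.Iic 0) = 0 := by
    rw [← ofReal_cdf, ENNReal.ofReal_eq_zero]
    exact h0
  rw [ae_iff]
  convert h1 using 2
  ext x
  simp

theorem integrable_exp_mul (h : IsMittagLefflerType1 ν κ ρ) (hκ : 0 < κ) {t : ℝ} (ht : t ≤ 0) :
    Integrable (fun x => Real.exp (t * x)) ρ := by
  have := h.isProbabilityMeasure
  refine Integrable.of_bound (by fun_prop) 1 ?_
  filter_upwards [h.ae_pos hκ] with x hx
  rw [Real.norm_of_nonneg (Real.exp_pos _).le, Real.exp_le_one_iff]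
  exact mul_nonpos_of_nonpos_of_nonneg ht hx.le

theorem integral_exp_neg_mul_mittagLeffler (h : IsMittagLefflerType1 ν κ ρ) (hκ : 0 < κ) {σ : ℝ}
    (hσ : 0 < σ) :
    ∫ t in Set.Ioi (0 : ℝ), Real.exp (-(σ * t)) * mittagLeffler κ (-(ν * t ^ κ)) =
      σ⁻¹ * (1 - ∫ x, Real.exp (-(σ * x)) ∂ρ) := by
  have := h.isProbabilityMeasure
  rw [← integral_exp_neg_mul_measureReal_Ioi (h.ae_pos hκ) hσ]
  refine setIntegral_congr_fun measurableSet_Ioi fun t ht => ?_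
  simp only [h.measureReal_Ioi ht]

/-- The formula holds for large `σ` by termwise integration and extends analytically over Re z < 0.
It is continued in the form M(z)(ν + (-z)^κ) = ν, so that no zeros of the denominator need be
excluded off the real axis. -/
theorem integral_exp_neg_mul (h : IsMittagLefflerType1 ν κ ρ) (hκ : 0 < κ) (hν : 0 < ν) {σ : ℝ}
    (hσ : 0 < σ) : ∫ x, Real.exp (-(σ * x)) ∂ρ = ν / (ν + σ ^ κ) := by
  have hlarge : ∀ σ : ℝ, 0 < σ → ν < σ ^ κ →
      ∫ x, Real.exp (-(σ * x)) ∂ρ = ν / (ν + σ ^ κ) := by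
    intro σ hσ hlt
    have h1 := integral_exp_neg_mul_mittagLeffler_of_lt hκ hν hσ hlt
    rw [h.integral_exp_neg_mul_mittagLeffler hκ hσ] at h1
    have h2 := mul_left_cancel₀ (inv_ne_zero hσ.ne') h1
    have : 0 < σ ^ κ := by positivity
    rw [sub_eq_iff_eq_add] at h2
    field_simp at h2 ⊢
    linarith
  set U : Set ℂ := {z | z.re < 0}
  have hU : IsPreconnected U := (convex_halfSpace_re_lt 0).isPreconnected
  have hUo : IsOpen U := isOpen_lt Complex.continuous_re continuous_const
  have hM : AnalyticOnNhd ℂ (complexMGF id ρ) U :=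
    analyticOnNhd_complexMGF.mono fun z hz =>
      interior_maximal (s := integrableExpSet id ρ) (t := Set.Iio 0)
        (fun t ht => h.integrable_exp_mul hκ (le_of_lt ht)) isOpen_Iio hz
  have hP : AnalyticOnNhd ℂ (fun z : ℂ => (ν : ℂ) + (-z) ^ (κ : ℂ)) U := by
    refine DifferentiableOn.analyticOnNhd (fun z hz => ?_) hUo
    have hz' : -z ∈ Complex.slitPlane := Or.inl (by simpa [U] using hz)
    exact ((differentiableAt_const _).add
      ((differentiableAt_id.neg).cpow_const hz')).differentiableWithinAt
  have hval (s : ℝ) : complexMGF id ρ ((-s : ℝ) : ℂ) = ((∫ x, Real.exp (-(s * x)) ∂ρ : ℝ) : ℂ) := by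
    rw [complexMGF_ofReal, mgf]
    simp
  have hpow (s : ℝ) (hs : 0 < s) :
      (ν : ℂ) + (-((-s : ℝ) : ℂ)) ^ (κ : ℂ) = ((ν + s ^ κ : ℝ) : ℂ) := by
    rw [← Complex.ofReal_neg, neg_neg, ← Complex.ofReal_cpow hs.le, Complex.ofReal_add]
  -- τ^κ = ν + 1 > ν, so a neighbourhood of -τ lies in the range of the series computation.
  set τ : ℝ := (ν + 1) ^ κ⁻¹
  have hτ : 0 < τ := by positivity
  have hEq := eqOn_of_eventually_eq_ofReal hU (hM.mul hP) (analyticOnNhd_const (v := (ν : ℂ)))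
    (t := -τ) (by simpa [U] using hτ) (by
      have hev : ∀ᶠ x : ℝ in nhds (-τ), 0 < -x ∧ ν < (-x) ^ κ := by
        have hc : Continuous fun x : ℝ => (-x) ^ κ :=
          (Real.continuous_rpow_const hκ.le).comp continuous_neg
        refine (continuous_neg.tendsto (-τ) |>.eventually (lt_mem_nhds ?_)).and
          ((hc.tendsto (-τ)).eventually (lt_mem_nhds ?_))
        · simpa using hτ
        · rw [neg_neg, Real.rpow_inv_rpow (by positivity) hκ.ne']
          linarith
      filter_upwards [hev] with x hx
      obtain ⟨s, rfl⟩ : ∃ s, x = -s := ⟨-x, by simp⟩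
      rw [neg_neg] at hx
      have := hpow s hx.1
      have hv := hval s
      have : 0 < ν + s ^ κ := by linarith [hx.2]
      change complexMGF id ρ ((-s : ℝ) : ℂ) * (_ + _) = _
      rw [hv, hpow s hx.1, hlarge s hx.1 hx.2, ← Complex.ofReal_mul,
        div_mul_cancel₀ _ this.ne'])
  have := hEq (x := ((-σ : ℝ) : ℂ)) (by simpa [U] using hσ)
  change complexMGF id ρ ((-σ : ℝ) : ℂ) * (_ + _) = _ at this
  rw [hval, hpow σ hσ, ← Complex.ofReal_mul, Complex.ofReal_inj] at this
  have hpos : 0 < ν + σ ^ κ := by positivity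
  rw [eq_div_iff hpos.ne', this]

end IsMittagLefflerType1

/-! ### The probability generating function of the fractional Poisson law -/

section Renewal

variable {ρ : Measure ℝ} [IsProbabilityMeasure ρ]

theorem ae_infinitePi_forall_pos (hρ : ∀ᵐ x ∂ρ, 0 < x) :
    ∀ᵐ δ ∂(Measure.infinitePi fun _ : ℕ => ρ), ∀ k, 0 < δ k := by
  rw [ae_all_iff]
  intro k
  exact (measurePreserving_eval_infinitePi (fun _ : ℕ => ρ) k).quasiMeasurePreserving.ae hρ

theorem integral_exp_mul_partialSum (t : ℝ) (n : ℕ) :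
    ∫ δ, Real.exp (t * ∑ k ∈ Finset.range n, δ k) ∂(Measure.infinitePi fun _ : ℕ => ρ) =
      (∫ x, Real.exp (t * x) ∂ρ) ^ n := by
  have hind : iIndepFun (fun (i : ℕ) (δ : ℕ → ℝ) => δ i) (Measure.infinitePi fun _ : ℕ => ρ) :=
    iIndepFun_infinitePi (P := fun _ : ℕ => ρ) (X := fun _ x => x) fun _ => measurable_id
  have h := hind.mgf_sum (t := t) (fun i => by fun_prop) (Finset.range n)
  have hk (k : ℕ) : mgf (fun δ : ℕ → ℝ => δ k) (Measure.infinitePi fun _ : ℕ => ρ) t =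
      ∫ x, Real.exp (t * x) ∂ρ := by
    rw [← mgf_id_map (measurable_pi_apply k).aemeasurable,
      Measure.infinitePi_map_eval (fun _ : ℕ => ρ) k]
    rfl
  simp only [hk, Finset.prod_const, Finset.card_range] at h
  rw [← h, mgf]
  simp

theorem integrable_exp_neg_mul_partialSum (hρ : ∀ᵐ x ∂ρ, 0 < x) {σ : ℝ} (hσ : 0 ≤ σ) (n : ℕ) :
    Integrable (fun δ : ℕ → ℝ => Real.exp (-σ * ∑ k ∈ Finset.range n, δ k))
      (Measure.infinitePi fun _ : ℕ => ρ) := by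
  refine Integrable.of_bound (by fun_prop) 1 ?_
  filter_upwards [ae_infinitePi_forall_pos hρ] with δ hδ
  rw [Real.norm_of_nonneg (Real.exp_pos _).le, Real.exp_le_one_iff]
  exact mul_nonpos_of_nonpos_of_nonneg (by linarith) (Finset.sum_nonneg fun k _ => (hδ k).le)

/-- The strict inequality gives geometric decay of the transforms of the partial sums, which forces
them to infinity. -/
theorem integral_exp_neg_lt_one (hρ : ∀ᵐ x ∂ρ, 0 < x) : ∫ x, Real.exp (-1 * x) ∂ρ < 1 := by
  have hi : Integrable (fun x => Real.exp (-1 * x)) ρ := by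
    refine Integrable.of_bound (by fun_prop) 1 ?_
    filter_upwards [hρ] with x hx
    rw [Real.norm_of_nonneg (Real.exp_pos _).le, Real.exp_le_one_iff]
    linarith
  have h := integral_pos_iff_support_of_nonneg_ae (μ := ρ) (f := fun x => 1 - Real.exp (-1 * x))
    (by
      filter_upwards [hρ] with x hx
      simp [hx.le]) ((integrable_const 1).sub hi)
  have hsupp : ρ (Function.support fun x => 1 - Real.exp (-1 * x)) = 1 := by
    rw [← measure_univ (μ := ρ)]
    refine measure_congr ?_
    filter_upwards [hρ] with x hx
    refine eq_true ?_ |>.trans (eq_true (Set.mem_univ x)).symm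
    have : Real.exp (-1 * x) < 1 := by
      rw [Real.exp_lt_one_iff]
      linarith
    exact (sub_pos.2 this).ne'
  rw [hsupp, integral_sub (integrable_const 1) hi] at h
  simpa using h.2 one_pos

/-- Chernoff's bound gives P(T_n ≤ t) ≤ e^t r^n with r < 1. This rules out the case where the
supremum defining `renewalCount` is over an unbounded set and defaults to 0. -/
theorem ae_infinitePi_exists_lt_partialSum (hρ : ∀ᵐ x ∂ρ, 0 < x) (t : ℝ) :
    ∀ᵐ δ ∂(Measure.infinitePi fun _ : ℕ => ρ), ∃ n, t < ∑ k ∈ Finset.range n, δ k := by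
  set r := ∫ x, Real.exp (-1 * x) ∂ρ with hr
  have hr1 : r < 1 := integral_exp_neg_lt_one hρ
  have hr0 : 0 ≤ r := integral_nonneg fun x => (Real.exp_pos _).le
  have hle (n : ℕ) : (Measure.infinitePi fun _ : ℕ => ρ).real
      {δ | ∀ n, ∑ k ∈ Finset.range n, δ k ≤ t} ≤ Real.exp t * r ^ n := by
    have hsub : {δ : ℕ → ℝ | ∀ n, ∑ k ∈ Finset.range n, δ k ≤ t} ⊆
        {δ | ∑ k ∈ Finset.range n, δ k ≤ t} := Set.ofPred_subset_ofPred.2 fun δ hδ => hδ n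
    have h1 := measure_le_le_exp_mul_mgf (μ := Measure.infinitePi fun _ : ℕ => ρ)
      (X := fun δ => ∑ k ∈ Finset.range n, δ k) (t := -1) t (by norm_num)
      (integrable_exp_neg_mul_partialSum hρ zero_le_one n)
    rw [mgf, integral_exp_mul_partialSum, neg_neg, one_mul] at h1
    exact (measureReal_mono hsub).trans h1
  have hlim : Tendsto (fun n : ℕ => Real.exp t * r ^ n) atTop (nhds 0) := by
    simpa using (tendsto_pow_atTop_nhds_zero_of_lt_one hr0 hr1).const_mul (Real.exp t)
  have h0 : (Measure.infinitePi fun _ : ℕ => ρ).real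
      {δ | ∀ n, ∑ k ∈ Finset.range n, δ k ≤ t} = 0 :=
    le_antisymm (ge_of_tendsto' hlim hle) measureReal_nonneg
  rw [ae_iff]
  rw [measureReal_eq_zero_iff] at h0
  convert h0 using 2
  ext δ
  simp

theorem lt_renewalCount_iff {δ : ℕ → ℝ} {t : ℝ} (ht : 0 ≤ t) (hδ : ∀ k, 0 < δ k)
    (hex : ∃ n, t < ∑ k ∈ Finset.range n, δ k) (n : ℕ) :
    n < renewalCount δ t ↔ ∑ k ∈ Finset.range (n + 1), δ k ≤ t := by
  have hmono : Monotone fun n => ∑ k ∈ Finset.range n, δ k := by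
    refine monotone_nat_of_le_succ fun n => ?_
    rw [Finset.sum_range_succ]
    linarith [hδ n]
  obtain ⟨N, hN⟩ := hex
  have hb : BddAbove {n : ℕ | ∑ k ∈ Finset.range n, δ k ≤ t} := by
    refine ⟨N, fun m hm => ?_⟩
    by_contra hlt
    exact absurd (hmono (not_le.1 hlt).le) (not_le.2 (lt_of_le_of_lt hm hN))
  have hne : {n : ℕ | ∑ k ∈ Finset.range n, δ k ≤ t}.Nonempty := ⟨0, by simpa using ht⟩
  constructor
  · intro h
    have hmem := Nat.sSup_mem hne hb
    exact (hmono (Nat.succ_le_of_lt h)).trans hmem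
  · intro h
    exact Nat.lt_of_succ_le (le_csSup hb h)

/-- The discounted sum of the laws of the arrival times of a renewal process. -/
def discountedRenewalMeasure (ρ : Measure ℝ) [IsProbabilityMeasure ρ] (z : ℝ) : Measure ℝ :=
  Measure.sum fun n : ℕ => ENNReal.ofReal (z ^ n) •
    (Measure.infinitePi fun _ : ℕ => ρ).map fun δ => ∑ k ∈ Finset.range (n + 1), δ k

/-- T_{n+1} has transform r^{n+1}, so the weighted sum is the geometric series r ∑ (zr)^n. -/
theorem lintegral_exp_discountedRenewalMeasure (hρ : ∀ᵐ x ∂ρ, 0 < x) {z σ : ℝ} (hz0 : 0 ≤ z)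
    (hz1 : z < 1) (hσ : 0 ≤ σ) :
    ∫⁻ x, ENNReal.ofReal (Real.exp (-σ * x)) ∂(discountedRenewalMeasure ρ z) =
      ENNReal.ofReal ((∫ x, Real.exp (-σ * x) ∂ρ) / (1 - z * ∫ x, Real.exp (-σ * x) ∂ρ)) := by
  set r := ∫ x, Real.exp (-σ * x) ∂ρ with hr
  have hr0 : 0 ≤ r := integral_nonneg fun x => (Real.exp_pos _).le
  have hr1 : r ≤ 1 := by
    rw [hr, ← probReal_univ (μ := ρ), ← mul_one (ρ.real Set.univ), ← smul_eq_mul,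
      ← integral_const]
    refine integral_mono_of_nonneg (.of_forall fun x => (Real.exp_pos _).le) (integrable_const _) ?_
    filter_upwards [hρ] with x hx
    rw [Real.exp_le_one_iff]
    exact mul_nonpos_of_nonpos_of_nonneg (by linarith) hx.le
  have hzr : z * r < 1 := by nlinarith
  have hzr0 : 0 ≤ z * r := by positivity
  rw [discountedRenewalMeasure, lintegral_sum_measure]
  have hterm (n : ℕ) : ∫⁻ x, ENNReal.ofReal (Real.exp (-σ * x)) ∂(ENNReal.ofReal (z ^ n) •
      (Measure.infinitePi fun _ : ℕ => ρ).map fun δ => ∑ k ∈ Finset.range (n + 1), δ k) =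
      ENNReal.ofReal (r * (z * r) ^ n) := by
    rw [lintegral_smul_measure, lintegral_map (by fun_prop) (by fun_prop),
      ← ofReal_integral_eq_lintegral_ofReal (integrable_exp_neg_mul_partialSum hρ hσ _)
        (.of_forall fun x => (Real.exp_pos _).le), integral_exp_mul_partialSum, smul_eq_mul,
      ← ENNReal.ofReal_mul (by positivity)]
    congr 1
    ring
  simp only [hterm]
  have hs := (summable_geometric_of_lt_one hzr0 hzr).mul_left r
  rw [← ENNReal.ofReal_tsum_of_nonneg (fun n => by positivity) hs, tsum_mul_left,
    tsum_geometric_of_lt_one hzr0 hzr, div_eq_mul_inv]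

/-- Almost surely T_{n+1} ≤ t exactly when n < N, so ∑ z^n 1{T_{n+1} ≤ t} is the finite geometric
sum (1 - z^N)/(1 - z). -/
theorem discountedRenewalMeasure_Iic (hρ : ∀ᵐ x ∂ρ, 0 < x) {z t : ℝ} (hz0 : 0 ≤ z)
    (hz1 : z < 1) (ht : 0 ≤ t) :
    discountedRenewalMeasure ρ z (Set.Iic t) = ENNReal.ofReal ((1 - z)⁻¹ *
      (1 - ∫ δ, z ^ renewalCount δ t ∂(Measure.infinitePi fun _ : ℕ => ρ))) := by
  have hmeas (n : ℕ) : MeasurableSet {δ : ℕ → ℝ | ∑ k ∈ Finset.range (n + 1), δ k ≤ t} :=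
    measurableSet_le (by fun_prop) measurable_const
  rw [discountedRenewalMeasure, Measure.sum_apply _ measurableSet_Iic]
  have hterm (n : ℕ) : (ENNReal.ofReal (z ^ n) • (Measure.infinitePi fun _ : ℕ => ρ).map
      fun δ => ∑ k ∈ Finset.range (n + 1), δ k) (Set.Iic t) =
      ∫⁻ δ, {δ : ℕ → ℝ | ∑ k ∈ Finset.range (n + 1), δ k ≤ t}.indicator
        (fun _ => ENNReal.ofReal (z ^ n)) δ ∂(Measure.infinitePi fun _ : ℕ => ρ) := by
    rw [lintegral_indicator_const (hmeas n), Measure.smul_apply,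
      Measure.map_apply (by fun_prop) measurableSet_Iic]
    rfl
  simp only [hterm]
  rw [← lintegral_tsum fun n => (measurable_const.indicator (hmeas n)).aemeasurable]
  have hpt : ∀ᵐ δ ∂(Measure.infinitePi fun _ : ℕ => ρ),
      ∑' n, {δ : ℕ → ℝ | ∑ k ∈ Finset.range (n + 1), δ k ≤ t}.indicator
        (fun _ => ENNReal.ofReal (z ^ n)) δ =
      ENNReal.ofReal ((1 - z)⁻¹ * (1 - z ^ renewalCount δ t)) := by
    filter_upwards [ae_infinitePi_forall_pos hρ, ae_infinitePi_exists_lt_partialSum hρ t]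
      with δ h1 h2
    have hiff := lt_renewalCount_iff ht h1 h2
    rw [tsum_eq_sum (s := Finset.range (renewalCount δ t))]
    · rw [Finset.sum_congr rfl (g := fun n => ENNReal.ofReal (z ^ n)),
        ← ENNReal.ofReal_sum_of_nonneg fun n _ => by positivity, geom_sum_eq hz1.ne]
      · congr 1
        rw [← neg_div_neg_eq, neg_sub, neg_sub, div_eq_inv_mul]
      · intro n hn
        rw [Set.indicator_of_mem]
        exact (hiff n).1 (Finset.mem_range.1 hn)
    · intro n hn
      rw [Set.indicator_of_notMem]
      exact fun h => hn (Finset.mem_range.2 ((hiff n).2 h))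
  have hi : Integrable (fun δ => z ^ renewalCount δ t) (Measure.infinitePi fun _ : ℕ => ρ) := by
    refine Integrable.of_bound
      ((measurable_from_nat (f := fun n => z ^ n)).comp
        (measurable_renewalCount t)).aestronglyMeasurable 1 (.of_forall fun δ => ?_)
    rw [Real.norm_of_nonneg (by positivity)]
    exact pow_le_one₀ hz0 hz1.le
  have hi' : Integrable (fun δ => (1 - z)⁻¹ * (1 - z ^ renewalCount δ t))
      (Measure.infinitePi fun _ : ℕ => ρ) := ((integrable_const 1).sub hi).const_mul _
  rw [lintegral_congr_ae hpt, ← ofReal_integral_eq_lintegral_ofReal hi', integral_const_mul,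
    integral_sub (integrable_const 1) hi]
  · simp
  · refine .of_forall fun δ => ?_
    have : z ^ renewalCount δ t ≤ 1 := pow_le_one₀ hz0 hz1.le
    exact mul_nonneg (inv_nonneg.2 (by linarith)) (by linarith)

end Renewal

/-- A geometric sum of type 1 Mittag-Leffler variables is again of this type, with thinned rate: r =
ν/(ν+σ^κ) gives r/(1-zr) = ν/(ν(1-z)+σ^κ). -/
theorem IsMittagLefflerType1.discountedRenewalMeasure_eq {ν κ z : ℝ} {ρ ρ' : Measure ℝ}
    [IsProbabilityMeasure ρ] (hκ : 0 < κ) (hν : 0 < ν) (hz0 : 0 ≤ z) (hz1 : z < 1)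
    (h : IsMittagLefflerType1 ν κ ρ) (h' : IsMittagLefflerType1 (ν * (1 - z)) κ ρ') :
    discountedRenewalMeasure ρ z = ENNReal.ofReal (1 - z)⁻¹ • ρ' := by
  have hz : 0 < 1 - z := by linarith
  have := h'.isProbabilityMeasure
  have hval : ∀ t ∈ Set.Ioo (-1 : ℝ) 0,
      ∫⁻ x, ENNReal.ofReal (Real.exp (t * x)) ∂(discountedRenewalMeasure ρ z) =
        ENNReal.ofReal (ν / (ν * (1 - z) + (-t) ^ κ)) := by
    intro t ht
    obtain ⟨σ, rfl⟩ : ∃ σ, t = -σ := ⟨-t, by simp⟩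
    have hσ : 0 < σ := by simpa using ht.2
    rw [lintegral_exp_discountedRenewalMeasure (h.ae_pos hκ) hz0 hz1 hσ.le]
    simp only [neg_mul]
    rw [h.integral_exp_neg_mul hκ hν hσ, neg_neg]
    have : 0 < σ ^ κ := by positivity
    have h1 : 0 < ν + σ ^ κ := by positivity
    have h2 : 0 < ν * (1 - z) + σ ^ κ := by positivity
    congr 1
    have h3 : 1 - z * (ν / (ν + σ ^ κ)) = (ν * (1 - z) + σ ^ κ) / (ν + σ ^ κ) := by
      field_simp
      ring
    rw [h3]
    field_simp
  refine Measure.ext_of_lintegral_exp_eqOn_Ioo (a := -1) (b := 0) (by norm_num)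
    (fun t ht => by rw [hval t ht]; exact ENNReal.ofReal_ne_top) fun t ht => ?_
  rw [hval t ht]
  obtain ⟨σ, rfl⟩ : ∃ σ, t = -σ := ⟨-t, by simp⟩
  have hσ : 0 < σ := by simpa using ht.2
  rw [lintegral_smul_measure, ← ofReal_integral_eq_lintegral_ofReal
    (h'.integrable_exp_mul hκ (by linarith)) (.of_forall fun x => (Real.exp_pos _).le),
    smul_eq_mul, ← ENNReal.ofReal_mul (by positivity)]
  simp only [neg_mul]
  rw [h'.integral_exp_neg_mul hκ (by positivity) hσ, neg_neg]
  have : 0 < σ ^ κ := by positivity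
  congr 1
  field_simp

/-- The probability generating function of the fractional Poisson law. -/
theorem IsFractionalPoisson.integral_pow {ν κ z : ℝ} {m : Measure ℕ} (hκ : 0 < κ) (hν : 0 < ν)
    (hz0 : 0 ≤ z) (hz1 : z < 1) (hm : IsFractionalPoisson ν κ m)
    (hex : ∃ ρ, IsMittagLefflerType1 (ν * (1 - z)) κ ρ) :
    ∫ n, z ^ n ∂m = mittagLeffler κ (-(ν * (1 - z))) := by
  obtain ⟨ρ, h, rfl⟩ := hm
  obtain ⟨ρ', h'⟩ := hex
  have := h.isProbabilityMeasure
  have := h'.isProbabilityMeasure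
  have hz : 0 < 1 - z := by linarith
  -- The mass of (-∞, 1] is read off once from the renewal count and once from the distribution
  -- function of `ρ'`.
  have h1 := discountedRenewalMeasure_Iic (h.ae_pos hκ) hz0 hz1 zero_le_one
  rw [h.discountedRenewalMeasure_eq hκ hν hz0 hz1 h', Measure.smul_apply, ← ofReal_cdf,
    h'.cdf_eq 1 one_pos, smul_eq_mul, ← ENNReal.ofReal_mul (by positivity)] at h1
  have hI : ∫ δ, z ^ renewalCount δ 1 ∂(Measure.infinitePi fun _ : ℕ => ρ) ≤ 1 := by
    rw [← probReal_univ (μ := Measure.infinitePi fun _ : ℕ => ρ), ← mul_one (Measure.real _ _),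
      ← smul_eq_mul, ← integral_const]
    exact integral_mono_of_nonneg (.of_forall fun x => by positivity) (integrable_const _)
      (.of_forall fun x => pow_le_one₀ hz0 hz1.le)
  have hc := cdf_nonneg ρ' 1
  rw [h'.cdf_eq 1 one_pos] at hc
  rw [ENNReal.ofReal_eq_ofReal_iff (by positivity)
    (mul_nonneg (by positivity) (by linarith))] at h1
  have h2 := mul_left_cancel₀ (inv_ne_zero hz.ne') h1
  rw [integral_map (measurable_renewalCount 1).aemeasurable
    (measurable_from_nat (f := fun n => z ^ n)).aestronglyMeasurable]
  rw [Real.one_rpow, mul_one] at h2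
  linarith

/-! ### The scaling limit of the fractional Poisson law -/

/-- The upper bound does not involve `ν`; this uniformity is what tightness needs. -/
theorem mul_one_sub_exp_neg_div_mem_Icc {l ν : ℝ} (hl : 0 ≤ l) (hν : 0 < ν) :
    ν * (1 - Real.exp (-(l / ν))) ∈ Set.Icc 0 l := by
  constructor
  · have : Real.exp (-(l / ν)) ≤ 1 := by
      rw [Real.exp_le_one_iff]
      simp only [Left.neg_nonpos_iff]
      positivity
    exact mul_nonneg hν.le (by linarith)
  · have h := Real.add_one_le_exp (-(l / ν))
    calc ν * (1 - Real.exp (-(l / ν))) ≤ ν * (l / ν) := by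
          gcongr
          linarith
      _ = l := by field_simp

/-- This is the derivative at 0 of 1 - e^{-lx}, taken along x = 1/ν. -/
theorem tendsto_mul_one_sub_exp_neg_div (l : ℝ) :
    Tendsto (fun ν : ℝ => ν * (1 - Real.exp (-(l / ν)))) atTop (nhds l) := by
  have hd : HasDerivAt (fun x : ℝ => 1 - Real.exp (-(l * x))) l 0 := by
    have h1 : HasDerivAt (fun x : ℝ => -(l * x)) (-(l * 1)) 0 :=
      ((hasDerivAt_id' (0 : ℝ)).const_mul l).neg
    convert! h1.exp.const_sub 1 using 1
    simp
  have h := hd.tendsto_slope_zero_right.comp tendsto_inv_atTop_nhdsGT_zero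
  refine h.congr fun ν => ?_
  simp [div_eq_mul_inv]

namespace IsFractionalPoisson

variable {κ ν : ℝ} {m : Measure ℕ}

theorem isProbabilityMeasure (hm : IsFractionalPoisson ν κ m) : IsProbabilityMeasure m := by
  obtain ⟨ρ, h, rfl⟩ := hm
  have := h.isProbabilityMeasure
  exact Measure.isProbabilityMeasure_map (measurable_renewalCount 1).aemeasurable

theorem integral_exp_neg_mul_div {l : ℝ} (hκ : 0 < κ) (hν : 0 < ν) (hl : 0 < l)
    (hex : ∀ μ : ℝ, 0 < μ → ∃ ρ, IsMittagLefflerType1 μ κ ρ) (hm : IsFractionalPoisson ν κ m) :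
    ∫ n : ℕ, Real.exp (-(l * (n / ν))) ∂m =
      mittagLeffler κ (-(ν * (1 - Real.exp (-(l / ν))))) := by
  have hlt : Real.exp (-(l / ν)) < 1 := by
    rw [Real.exp_lt_one_iff]
    simp only [Left.neg_neg_iff]
    positivity
  rw [← hm.integral_pow hκ hν (Real.exp_pos _).le hlt
    (hex _ (mul_pos hν (by linarith)))]
  congr with n
  rw [← Real.exp_nat_mul]
  congr 1
  ring

end IsFractionalPoisson

/-- If the waiting time laws exist for all rates, then `l ↦ E_κ(-l)` is the Laplace transform of a
probability measure on `[0, ∞)`. -/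
theorem exists_laplace_eq_mittagLeffler {κ : ℝ} (hκ : 0 < κ)
    (hex : ∀ μ : ℝ, 0 < μ → ∃ ρ, IsMittagLefflerType1 μ κ ρ) :
    ∃ Q : Measure ℝ, IsProbabilityMeasure Q ∧ (∀ᵐ u ∂Q, 0 ≤ u) ∧
      ∀ l : ℝ, 0 < l → ∫ u, Real.exp (-(l * u)) ∂Q = mittagLeffler κ (-l) := by
  have hfp (n : ℕ) : ∃ m, IsFractionalPoisson ((n : ℝ) + 1) κ m := by
    obtain ⟨ρ, h⟩ := hex (n + 1) (by positivity)
    exact ⟨_, ρ, h, rfl⟩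
  choose m hm using hfp
  have := fun n => (hm n).isProbabilityMeasure
  have hmeas (n : ℕ) : Measurable fun k : ℕ => (k : NNReal) / ((n : NNReal) + 1) :=
    measurable_from_nat
  -- The laws of N/ν for ν = n + 1. They are placed on [0, ∞), where e^{-lu} is a bounded continuous
  -- test function.
  set q : ℕ → ProbabilityMeasure NNReal := fun n =>
    ⟨(m n).map fun k : ℕ => (k : NNReal) / ((n : NNReal) + 1),
      Measure.isProbabilityMeasure_map (hmeas n).aemeasurable⟩ with hq
  have hlap (n : ℕ) (l : ℝ) (hl : 0 < l) : ∫ u : NNReal, Real.exp (-(l * u)) ∂(q n : Measure NNReal)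
      = mittagLeffler κ (-(((n : ℝ) + 1) * (1 - Real.exp (-(l / ((n : ℝ) + 1)))))) := by
    rw [← (hm n).integral_exp_neg_mul_div hκ (by positivity) hl hex]
    change ∫ u : NNReal, Real.exp (-(l * u))
      ∂((m n).map fun k : ℕ => (k : NNReal) / ((n : NNReal) + 1)) = _
    rw [integral_map (hmeas n).aemeasurable
      (by fun_prop : Measurable fun u : NNReal => Real.exp (-(l * u))).aestronglyMeasurable]
    simp
  have hbdd (n : ℕ) (l : ℝ) (hl : 0 ≤ l) :
      Integrable (fun u : NNReal => Real.exp (-(l * u))) (q n : Measure NNReal) := by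
    refine Integrable.of_bound (by fun_prop : Measurable fun u : NNReal =>
      Real.exp (-(l * u))).aestronglyMeasurable 1 (.of_forall fun u => ?_)
    rw [Real.norm_of_nonneg (Real.exp_pos _).le, Real.exp_le_one_iff]
    simp only [Left.neg_nonpos_iff]
    positivity
  have htight : IsTightMeasureSet {((μ : ProbabilityMeasure NNReal) : Measure NNReal) |
      μ ∈ Set.range q} := by
    rw [isTightMeasureSet_iff_exists_isCompact_measure_compl_le]
    intro ε hε
    obtain ⟨ε', hε', hε'ε⟩ : ∃ ε' : ℝ, 0 < ε' ∧ ENNReal.ofReal ε' ≤ ε := by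
      obtain ⟨e, he0, he⟩ := ENNReal.lt_iff_exists_nnreal_btwn.1 hε
      exact ⟨e, by exact_mod_cast he0, by simpa using he.le⟩
    -- 1 - e^{-lu} ≥ c as soon as u > 1/l, so the Laplace transform near 0 controls the tails by
    -- Markov's inequality.
    set c : ℝ := 1 - Real.exp (-1)
    have hc : 0 < c := sub_pos.2 (by rw [Real.exp_lt_one_iff]; norm_num)
    have hcont : Tendsto (fun x : ℝ => mittagLeffler κ (-x)) (nhds 0) (nhds 1) := by
      have : Continuous fun x : ℝ => mittagLeffler κ (-x) :=
        (continuous_mittagLeffler hκ).comp continuous_neg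
      simpa [mittagLeffler_zero] using this.tendsto 0
    have hnear := hcont.eventually (lt_mem_nhds (b := 1) (a := 1 - c * ε')
      (by have := mul_pos hc hε'; linarith))
    obtain ⟨d, hd, hdball⟩ := Metric.eventually_nhds_iff.1 hnear
    -- The argument of E_κ(-·) lies in [0, l] for every n, hence within `d` of 0.
    set l : ℝ := d / 2
    have hl : 0 < l := by positivity
    refine ⟨Set.Icc 0 (Real.toNNReal l⁻¹), isCompact_Icc, ?_⟩
    rintro _ ⟨_, ⟨n, rfl⟩, rfl⟩
    have hmem := mul_one_sub_exp_neg_div_mem_Icc hl.le (by positivity : (0 : ℝ) < n + 1)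
    have hE : 1 - c * ε' < ∫ u : NNReal, Real.exp (-(l * u)) ∂(q n : Measure NNReal) := by
      rw [hlap n l hl]
      refine hdball ?_
      rw [Real.dist_eq, sub_zero, abs_of_nonneg hmem.1]
      exact lt_of_le_of_lt hmem.2 (half_lt_self hd)
    set A : Set NNReal := (Set.Icc 0 (Real.toNNReal l⁻¹))ᶜ
    have hA : MeasurableSet A := measurableSet_Icc.compl
    have h1 : c * (q n : Measure NNReal).real A ≤
        ∫ u : NNReal, (1 - Real.exp (-(l * u))) ∂(q n : Measure NNReal) := by
      have : c * (q n : Measure NNReal).real A =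
          ∫ u, A.indicator (fun _ => c) u ∂(q n : Measure NNReal) := by
        rw [integral_indicator_const _ hA, smul_eq_mul, mul_comm]
      rw [this]
      refine integral_mono ((integrable_const c).indicator hA)
        ((integrable_const 1).sub (hbdd n l hl.le)) fun u => ?_
      have hle : Real.exp (-(l * u)) ≤ 1 := by
        rw [Real.exp_le_one_iff]
        simp only [Left.neg_nonpos_iff]
        positivity
      by_cases hu : u ∈ A
      · simp only [Set.indicator_of_mem hu, c]
        have hu' : Real.toNNReal l⁻¹ < u := by
          by_contra hcon
          exact hu ⟨zero_le, not_lt.1 hcon⟩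
        rw [Real.toNNReal_lt_iff_lt_coe (by positivity), inv_lt_iff_one_lt_mul₀' hl] at hu'
        gcongr
      · simp only [Set.indicator_of_notMem hu]
        linarith
    rw [integral_sub (integrable_const 1) (hbdd n l hl.le)] at h1
    simp only [integral_const, probReal_univ, smul_eq_mul, mul_one] at h1
    have h2 : (q n : Measure NNReal).real A ≤ ε' := le_of_mul_le_mul_left (by linarith) hc
    rw [← ENNReal.ofReal_toReal (measure_ne_top (q n : Measure NNReal) A)]
    exact (ENNReal.ofReal_le_ofReal h2).trans hε'ε
  have hcomp := isCompact_closure_of_isTightMeasureSet htight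
  -- A limit along an ultrafilter suffices: only the existence of `Q` is wanted, and the transforms
  -- converge anyway.
  obtain ⟨Q, -, hQ⟩ := hcomp.ultrafilter_le_nhds ((hyperfilter ℕ).map q) (by
    rw [le_principal_iff, Ultrafilter.mem_coe, Ultrafilter.mem_map]
    exact univ_mem' fun n => subset_closure ⟨n, rfl⟩)
  have hQ' : Tendsto q (hyperfilter ℕ : Filter ℕ) (nhds Q) := hQ
  rw [ProbabilityMeasure.tendsto_iff_forall_integral_tendsto] at hQ'
  have hcoe : Measurable ((↑) : NNReal → ℝ) := measurable_coe_nnreal_real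
  refine ⟨(Q : Measure NNReal).map (↑), Measure.isProbabilityMeasure_map hcoe.aemeasurable, ?_, ?_⟩
  · rw [ae_map_iff hcoe.aemeasurable measurableSet_Ici]
    exact .of_forall fun u => u.2
  · intro l hl
    rw [integral_map hcoe.aemeasurable (by fun_prop)]
    set f : BoundedContinuousFunction NNReal ℝ := BoundedContinuousFunction.ofNormedAddCommGroup
      (fun u : NNReal => Real.exp (-(l * u))) (by fun_prop) 1 (fun u => by
        rw [Real.norm_of_nonneg (Real.exp_pos _).le, Real.exp_le_one_iff]
        simp only [Left.neg_nonpos_iff]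
        positivity)
    refine tendsto_nhds_unique (hQ' f) ?_
    have hf (n : ℕ) : ∫ u, f u ∂(q n : Measure NNReal) =
        mittagLeffler κ (-(((n : ℝ) + 1) * (1 - Real.exp (-(l / ((n : ℝ) + 1)))))) := hlap n l hl
    simp only [hf]
    have hat : Tendsto (fun n : ℕ => (n : ℝ) + 1) (hyperfilter ℕ : Filter ℕ) atTop :=
      (tendsto_atTop_add_const_right _ _ tendsto_natCast_atTop_atTop).mono_left
        Nat.hyperfilter_le_atTop
    exact ((continuous_mittagLeffler hκ).comp continuous_neg).tendsto l |>.comp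
      ((tendsto_mul_one_sub_exp_neg_div l).comp hat)

/-! ### The Mellin transform of the mixing law -/

theorem lintegral_Ioi_ofReal_eq {f : ℝ → ℝ} {c : ℝ} (hc : 0 < c)
    (hf : ∀ t : ℝ, 0 < t → 0 ≤ f t) (h : ∫ t in Set.Ioi (0 : ℝ), f t = c) :
    ∫⁻ t in Set.Ioi (0 : ℝ), ENNReal.ofReal (f t) = ENNReal.ofReal c := by
  have hi : IntegrableOn f (Set.Ioi 0) := Integrable.of_integral_ne_zero (by rw [h]; exact hc.ne')
  rw [← h, ofReal_integral_eq_lintegral_ofReal hi]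
  filter_upwards [ae_restrict_mem measurableSet_Ioi] with t ht using hf t ht

theorem lintegral_rpow_mul_exp_neg_mul_rpow {κ p u : ℝ} (hκ : 0 < κ) (hp : 0 < p) (hu : 0 < u) :
    ∫⁻ t in Set.Ioi (0 : ℝ), ENNReal.ofReal (t ^ (κ * p - 1) * Real.exp (-(u * t ^ κ))) =
      ENNReal.ofReal (Real.Gamma p / κ * u ^ (-p)) := by
  have hG := Real.Gamma_pos_of_pos hp
  refine lintegral_Ioi_ofReal_eq (by positivity) (fun t ht => by positivity) ?_
  have h := integral_rpow_mul_exp_neg_mul_rpow (p := κ) (q := κ * p - 1) (b := u) hκ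
    (by nlinarith [mul_pos hκ hp]) hu
  have h1 : (κ * p - 1 + 1) / κ = p := by
    field_simp
    ring
  rw [neg_div, h1] at h
  simp only [← neg_mul]
  rw [h]
  ring

theorem lintegral_rpow_mul_exp_neg_mul {p u : ℝ} (hp : 0 < p) (hu : 0 < u) :
    ∫⁻ t in Set.Ioi (0 : ℝ), ENNReal.ofReal (t ^ (p - 1) * Real.exp (-(u * t))) =
      ENNReal.ofReal (Real.Gamma p * u ^ (-p)) := by
  simpa using lintegral_rpow_mul_exp_neg_mul_rpow one_pos hp hu

/-- Write 1/(1+σ^κ) = ∫ e^{-y(1+σ^κ)} dy and apply Tonelli; both resulting integrals are Gamma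
integrals. -/
theorem lintegral_rpow_mul_inv_one_add_rpow {κ s : ℝ} (hκ : 0 < κ) (hs0 : 0 < s) (hs1 : s < 1) :
    ∫⁻ σ in Set.Ioi (0 : ℝ), ENNReal.ofReal (σ ^ (κ * (1 - s) - 1) * (1 + σ ^ κ)⁻¹) =
      ENNReal.ofReal (Real.Gamma (1 - s) / κ * Real.Gamma s) := by
  have hs : 0 < 1 - s := by linarith
  have h1 : ∀ σ ∈ Set.Ioi (0 : ℝ), ENNReal.ofReal (σ ^ (κ * (1 - s) - 1) * (1 + σ ^ κ)⁻¹) =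
      ∫⁻ y in Set.Ioi (0 : ℝ), ENNReal.ofReal (Real.exp (-y)) *
        ENNReal.ofReal (σ ^ (κ * (1 - s) - 1) * Real.exp (-(y * σ ^ κ))) := by
    intro σ hσ
    have hσ0 : (0 : ℝ) < σ := hσ
    have h2 := lintegral_rpow_mul_exp_neg_mul (p := 1) (u := 1 + σ ^ κ) one_pos (by positivity)
    rw [Real.Gamma_one, one_mul, Real.rpow_neg_one] at h2
    rw [ENNReal.ofReal_mul (by positivity), ← h2, ← lintegral_const_mul _ (by fun_prop)]
    refine setLIntegral_congr_fun measurableSet_Ioi fun y hy => ?_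
    rw [← ENNReal.ofReal_mul (by positivity), ← ENNReal.ofReal_mul (by positivity)]
    congr 1
    rw [sub_self, Real.rpow_zero, one_mul, mul_left_comm, ← Real.exp_add]
    congr 2
    ring
  rw [setLIntegral_congr_fun measurableSet_Ioi h1, lintegral_lintegral_swap (by fun_prop)]
  have h3 : ∀ y ∈ Set.Ioi (0 : ℝ), ∫⁻ σ in Set.Ioi (0 : ℝ), ENNReal.ofReal (Real.exp (-y)) *
        ENNReal.ofReal (σ ^ (κ * (1 - s) - 1) * Real.exp (-(y * σ ^ κ))) =
      ENNReal.ofReal (Real.Gamma (1 - s) / κ) *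
        ENNReal.ofReal (y ^ (s - 1) * Real.exp (-(1 * y))) := by
    intro y hy
    have hy0 : (0 : ℝ) < y := hy
    have := Real.Gamma_pos_of_pos hs
    rw [lintegral_const_mul _ (by fun_prop), lintegral_rpow_mul_exp_neg_mul_rpow hκ hs hy,
      ← ENNReal.ofReal_mul (by positivity), ← ENNReal.ofReal_mul (by positivity), neg_sub, one_mul]
    congr 1
    ring
  have := Real.Gamma_pos_of_pos hs
  rw [setLIntegral_congr_fun measurableSet_Ioi h3, lintegral_const_mul _ (by fun_prop),
    lintegral_rpow_mul_exp_neg_mul hs0 one_pos, ← ENNReal.ofReal_mul (by positivity),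
    Real.one_rpow, mul_one]

/-- Γ(1-κs) t^{κs-1} = ∫ σ^{-κs} e^{-tσ} dσ, so Tonelli expresses the Mellin transform of `g`
through its Laplace transform. -/
theorem lintegral_rpow_mul_of_laplace_eq {κ s : ℝ} (hκ : 0 < κ) (hκ1 : κ ≤ 1) (hs0 : 0 < s)
    (hs1 : s < 1) {g : ℝ → ℝ} (hg : Measurable g) (hg0 : ∀ t : ℝ, 0 < t → 0 ≤ g t)
    (hlap : ∀ σ : ℝ, 0 < σ →
      ∫ t in Set.Ioi (0 : ℝ), Real.exp (-(σ * t)) * g t = σ⁻¹ * σ ^ κ * (1 + σ ^ κ)⁻¹) :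
    ENNReal.ofReal (Real.Gamma (1 - κ * s)) *
        ∫⁻ t in Set.Ioi (0 : ℝ), ENNReal.ofReal (t ^ (κ * s - 1) * g t) =
      ENNReal.ofReal (Real.Gamma (1 - s) / κ * Real.Gamma s) := by
  have hκs : 0 < 1 - κ * s := by nlinarith
  have hG := Real.Gamma_pos_of_pos hκs
  rw [← lintegral_rpow_mul_inv_one_add_rpow hκ hs0 hs1, ← lintegral_const_mul _ (by fun_prop)]
  have h1 : ∀ t ∈ Set.Ioi (0 : ℝ), ENNReal.ofReal (Real.Gamma (1 - κ * s)) *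
      ENNReal.ofReal (t ^ (κ * s - 1) * g t) =
      ∫⁻ σ in Set.Ioi (0 : ℝ), ENNReal.ofReal (g t) *
        ENNReal.ofReal (σ ^ (1 - κ * s - 1) * Real.exp (-(t * σ))) := by
    intro t ht
    have ht0 : (0 : ℝ) < t := ht
    rw [lintegral_const_mul _ (by fun_prop), lintegral_rpow_mul_exp_neg_mul hκs ht,
      ← ENNReal.ofReal_mul hG.le, ← ENNReal.ofReal_mul (hg0 t ht), neg_sub]
    congr 1
    ring
  rw [setLIntegral_congr_fun measurableSet_Ioi h1, lintegral_lintegral_swap (by fun_prop)]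
  refine setLIntegral_congr_fun measurableSet_Ioi fun σ hσ => ?_
  have hσ0 : (0 : ℝ) < σ := hσ
  have h2 : ∀ t ∈ Set.Ioi (0 : ℝ), ENNReal.ofReal (g t) *
        ENNReal.ofReal (σ ^ (1 - κ * s - 1) * Real.exp (-(t * σ))) =
      ENNReal.ofReal (σ ^ (1 - κ * s - 1)) * ENNReal.ofReal (Real.exp (-(σ * t)) * g t) := by
    intro t ht
    rw [← ENNReal.ofReal_mul (hg0 t ht), ← ENNReal.ofReal_mul (by positivity)]
    congr 1
    rw [mul_comm t σ]
    ring
  have h5 := lintegral_Ioi_ofReal_eq (by positivity)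
    (fun t ht => mul_nonneg (Real.exp_pos _).le (hg0 t ht)) (hlap σ hσ)
  rw [setLIntegral_congr_fun measurableSet_Ioi h2, lintegral_const_mul _ (by fun_prop), h5,
    ← ENNReal.ofReal_mul (by positivity)]
  congr 1
  rw [← Real.rpow_neg_one σ, ← mul_assoc, ← Real.rpow_add hσ0, ← Real.rpow_add hσ0]
  congr 2
  ring

section MixingLaw

variable {κ : ℝ} {ρ Q : Measure ℝ} [IsProbabilityMeasure Q]

theorem integrable_exp_neg_mul_of_ae_nonneg (hQ : ∀ᵐ u ∂Q, 0 ≤ u) {l : ℝ} (hl : 0 ≤ l) :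
    Integrable (fun u => Real.exp (-(l * u))) Q := by
  refine Integrable.of_bound (by fun_prop) 1 ?_
  filter_upwards [hQ] with u hu
  rw [Real.norm_of_nonneg (Real.exp_pos _).le, Real.exp_le_one_iff]
  simp only [Left.neg_nonpos_iff]
  positivity

/-- An atom at 0 is bounded by every value E_κ(-t^κ) of the Laplace transform. These values are the
tails of `ρ`, so they tend to 0. -/
theorem ae_pos_of_laplace_eq_mittagLeffler (hρ : IsMittagLefflerType1 1 κ ρ)
    (hQ : ∀ᵐ u ∂Q, 0 ≤ u)
    (hlap : ∀ l : ℝ, 0 < l → ∫ u, Real.exp (-(l * u)) ∂Q = mittagLeffler κ (-l)) :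
    ∀ᵐ u ∂Q, 0 < u := by
  have := hρ.isProbabilityMeasure
  have hle (t : ℝ) (ht : 0 < t) : Q.real {0} ≤ 1 - cdf ρ t := by
    have htκ : 0 < t ^ κ := by positivity
    have h1 : ∫ u, Real.exp (-(t ^ κ * u)) ∂Q = 1 - cdf ρ t := by
      rw [hlap _ htκ, hρ.cdf_eq t ht, one_mul, sub_sub_cancel]
    rw [← h1, ← integral_indicator_one (measurableSet_singleton (0 : ℝ))]
    refine integral_mono ((integrable_const (1 : ℝ)).indicator (measurableSet_singleton 0))
      (integrable_exp_neg_mul_of_ae_nonneg hQ htκ.le) fun u => ?_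
    by_cases hu : u = 0
    · simp [hu]
    · simp [hu, (Real.exp_pos _).le]
  have hlim : Tendsto (fun t => 1 - cdf ρ t) atTop (nhds 0) := by
    simpa using (tendsto_cdf_atTop ρ).const_sub 1
  have h0 : Q.real {0} = 0 := le_antisymm
    (ge_of_tendsto hlim ((eventually_gt_atTop 0).mono hle)) measureReal_nonneg
  rw [measureReal_eq_zero_iff] at h0
  have hne : ∀ᵐ u ∂Q, u ≠ 0 := by
    rw [ae_iff]
    simpa using h0
  filter_upwards [hQ, hne] with u h1 h2 using lt_of_le_of_ne h1 h2.symm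

/-- The Mellin transform of a law with Laplace transform `E_κ(-l)`. -/
theorem lintegral_rpow_neg_of_laplace_eq_mittagLeffler (hκ : 0 < κ) (hκ1 : κ ≤ 1)
    (hρ : IsMittagLefflerType1 1 κ ρ) (hQ : ∀ᵐ u ∂Q, 0 ≤ u)
    (hlap : ∀ l : ℝ, 0 < l → ∫ u, Real.exp (-(l * u)) ∂Q = mittagLeffler κ (-l)) {s : ℝ}
    (hs0 : 0 < s) (hs1 : s < 1) :
    ∫⁻ u, ENNReal.ofReal (u ^ (-s)) ∂Q =
      ENNReal.ofReal (Real.Gamma (1 - s) / Real.Gamma (1 - κ * s)) := by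
  have := hρ.isProbabilityMeasure
  have hpos := ae_pos_of_laplace_eq_mittagLeffler hρ hQ hlap
  have hκs : 0 < 1 - κ * s := by nlinarith
  have hG := Real.Gamma_pos_of_pos hκs
  have hGs := Real.Gamma_pos_of_pos hs0
  have hG1 := Real.Gamma_pos_of_pos (by linarith : 0 < 1 - s)
  have hE (t : ℝ) (ht : 0 < t) : mittagLeffler κ (-t ^ κ) = ρ.real (Set.Ioi t) := by
    rw [hρ.measureReal_Ioi ht, one_mul]
  have hcont : Continuous fun t : ℝ => mittagLeffler κ (-t ^ κ) :=
    (continuous_mittagLeffler hκ).comp (Real.continuous_rpow_const hκ.le).neg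
  -- the integral of `t ^ (κ s - 1) E_κ(-t ^ κ)`, computed in two ways
  set B : ENNReal := ∫⁻ t in Set.Ioi (0 : ℝ),
    ENNReal.ofReal (t ^ (κ * s - 1) * mittagLeffler κ (-t ^ κ))
  -- First evaluation: E_κ(-t^κ) is written as the Laplace transform of `Q` at t^κ, and t is
  -- integrated first.
  have hB1 : B = ENNReal.ofReal (Real.Gamma s / κ) * ∫⁻ u, ENNReal.ofReal (u ^ (-s)) ∂Q := by
    have h1 : ∀ t ∈ Set.Ioi (0 : ℝ),
        ENNReal.ofReal (t ^ (κ * s - 1) * mittagLeffler κ (-t ^ κ)) =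
        ∫⁻ u, ENNReal.ofReal (t ^ (κ * s - 1) * Real.exp (-(u * t ^ κ))) ∂Q := by
      intro t ht
      have ht0 : (0 : ℝ) < t := ht
      have htκ : 0 < t ^ κ := by positivity
      simp only [mul_comm _ (t ^ κ)]
      rw [← ofReal_integral_eq_lintegral_ofReal
        ((integrable_exp_neg_mul_of_ae_nonneg hQ htκ.le).const_mul _)
        (.of_forall fun u => by positivity), integral_const_mul, hlap _ htκ]
    rw [← lintegral_const_mul _ (by fun_prop)]
    change ∫⁻ t in Set.Ioi (0 : ℝ), _ = _
    rw [setLIntegral_congr_fun measurableSet_Ioi h1, lintegral_lintegral_swap (by fun_prop)]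
    refine lintegral_congr_ae ?_
    filter_upwards [hpos] with u hu
    rw [lintegral_rpow_mul_exp_neg_mul_rpow hκ hs0 hu, ENNReal.ofReal_mul (by positivity)]
  -- Second evaluation: t ↦ E_κ(-t^κ) is the tail of `ρ`, whose Laplace transform is explicit.
  have hB2 : ENNReal.ofReal (Real.Gamma (1 - κ * s)) * B =
      ENNReal.ofReal (Real.Gamma (1 - s) / κ * Real.Gamma s) := by
    refine lintegral_rpow_mul_of_laplace_eq hκ hκ1 hs0 hs1 hcont.measurable (fun t ht => ?_)
      fun σ hσ => ?_
    · rw [hE t ht]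
      exact measureReal_nonneg
    · have h3 := hρ.integral_exp_neg_mul_mittagLeffler hκ hσ
      rw [hρ.integral_exp_neg_mul hκ one_pos hσ] at h3
      simp only [one_mul] at h3
      rw [h3]
      have hσκ : 0 < σ ^ κ := by positivity
      field_simp
      ring
  rw [hB1, ← mul_assoc, ← ENNReal.ofReal_mul hG.le] at hB2
  have hc : 0 < Real.Gamma (1 - κ * s) * (Real.Gamma s / κ) := by positivity
  have hval : Real.Gamma (1 - s) / κ * Real.Gamma s = Real.Gamma (1 - κ * s) * (Real.Gamma s / κ) *
      (Real.Gamma (1 - s) / Real.Gamma (1 - κ * s)) := by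
    rw [mul_comm κ s] at hG ⊢
    field_simp
  rw [hval, ENNReal.ofReal_mul hc.le] at hB2
  exact (ENNReal.mul_right_inj (by simpa using hc) ENNReal.ofReal_ne_top).1 hB2

end MixingLaw

/-! ### The type 2 Mittag-Leffler density -/

theorem withDensity_rpow_integrable_exp {p t : ℝ} (hp : 0 < p) (ht : t < 0) :
    Integrable (fun x => Real.exp (t * x))
      ((volume.restrict (Set.Ioi 0)).withDensity fun x : ℝ => ENNReal.ofReal (x ^ (p - 1))) := by
  rw [integrable_withDensity_iff_integrable_smul₀' (by fun_prop)
    (.of_forall fun x => ENNReal.ofReal_lt_top)]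
  have h := integrableOn_rpow_mul_exp_neg hp (neg_pos.2 ht)
  refine (integrableOn_congr_fun (fun x hx => ?_) measurableSet_Ioi).1 h
  have hx0 : (0 : ℝ) < x := hx
  simp only [smul_eq_mul, neg_mul, neg_neg]
  rw [ENNReal.toReal_ofReal (by positivity)]

/-- Euler's integral for the Gamma function with a complex rate. -/
theorem integral_rpow_mul_cexp_neg_mul {p : ℝ} (hp : 0 < p) {c : ℂ} (hc : 0 < c.re) :
    ∫ t in Set.Ioi (0 : ℝ), ((t ^ (p - 1) : ℝ) : ℂ) * Complex.exp (-(c * t)) =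
      c ^ (-p : ℂ) * Real.Gamma p := by
  set μ : Measure ℝ :=
    (volume.restrict (Set.Ioi 0)).withDensity fun x : ℝ => ENNReal.ofReal (x ^ (p - 1)) with hμ
  set U : Set ℂ := {z | z.re < 0}
  have hU : IsPreconnected U := (convex_halfSpace_re_lt 0).isPreconnected
  have hUo : IsOpen U := isOpen_lt Complex.continuous_re continuous_const
  have hM : AnalyticOnNhd ℂ (complexMGF id μ) U :=
    analyticOnNhd_complexMGF.mono fun z hz =>
      interior_maximal (s := integrableExpSet id μ) (t := Set.Iio 0)
        (fun t ht => withDensity_rpow_integrable_exp hp ht) isOpen_Iio hz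
  have hP : AnalyticOnNhd ℂ (fun z : ℂ => (-z) ^ (-p : ℂ) * Real.Gamma p) U := by
    refine DifferentiableOn.analyticOnNhd (fun z hz => ?_) hUo
    have hz' : -z ∈ Complex.slitPlane := Or.inl (by simpa [U] using hz)
    exact (((differentiableAt_id.neg).cpow_const hz').mul_const _).differentiableWithinAt
  have hval (z : ℂ) : complexMGF id μ z =
      ∫ t in Set.Ioi (0 : ℝ), ((t ^ (p - 1) : ℝ) : ℂ) * Complex.exp (z * t) := by
    rw [complexMGF, hμ, integral_withDensity_eq_integral_toReal_smul (by fun_prop)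
      (.of_forall fun x => ENNReal.ofReal_lt_top)]
    refine setIntegral_congr_fun measurableSet_Ioi fun t ht => ?_
    have ht0 : (0 : ℝ) < t := ht
    simp only [id]
    rw [ENNReal.toReal_ofReal (by positivity), Complex.real_smul]
  have hEq := eqOn_of_eventually_eq_ofReal hU hM hP (t := -1) (by simp [U]) (by
    filter_upwards [Iio_mem_nhds (by norm_num : (-1 : ℝ) < 0)] with x hx
    obtain ⟨s, rfl⟩ : ∃ s, x = -s := ⟨-x, by simp⟩
    have hs : 0 < s := by simpa using hx
    rw [hval, Complex.ofReal_neg, neg_neg, ← Complex.ofReal_neg p, ← Complex.ofReal_cpow hs.le,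
      ← Complex.ofReal_mul]
    have h := Real.integral_rpow_mul_exp_neg_mul_Ioi hp hs
    rw [one_div, Real.inv_rpow hs.le, ← Real.rpow_neg hs.le] at h
    rw [← h, ← integral_complex_ofReal]
    congr with t
    push_cast
    rw [neg_mul])
  have h := hEq (x := -c) (by simpa [U] using hc)
  simp only [hval, neg_neg, neg_mul] at h
  exact h

theorem ofReal_mul_exp_mul_I_cpow {R θ : ℝ} (hR : 0 < R) (h1 : -Real.pi < θ) (h2 : θ ≤ Real.pi)
    (q : ℝ) : ((R : ℂ) * Complex.exp (θ * Complex.I)) ^ (q : ℂ) =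
      ((R ^ q : ℝ) : ℂ) * Complex.exp ((θ * q : ℝ) * Complex.I) := by
  have hne : (R : ℂ) * Complex.exp (θ * Complex.I) ≠ 0 :=
    mul_ne_zero (Complex.ofReal_ne_zero.2 hR.ne') (Complex.exp_ne_zero _)
  have hlog : Complex.log ((R : ℂ) * Complex.exp (θ * Complex.I)) =
      Real.log R + θ * Complex.I := by
    rw [Complex.log_ofReal_mul hR (Complex.exp_ne_zero _), Complex.log_exp]
    · simpa using h1
    · simpa using h2
  rw [Complex.cpow_def_of_ne_zero hne, hlog, Real.rpow_def_of_pos hR, Complex.ofReal_exp,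
    ← Complex.exp_add]
  congr 1
  push_cast
  ring

theorem ofReal_mul_exp_mul_I_re (R θ : ℝ) :
    ((R : ℂ) * Complex.exp (θ * Complex.I)).re = R * Real.cos θ := by
  rw [Complex.re_ofReal_mul, Complex.exp_ofReal_mul_I_re]

theorem integral_rpow_mul_cexp_neg_polar_mul {p R θ : ℝ} (hp : 0 < p) (hR : 0 < R)
    (h1 : -(Real.pi / 2) < θ) (h2 : θ < Real.pi / 2) :
    ∫ t in Set.Ioi (0 : ℝ), ((t ^ (p - 1) : ℝ) : ℂ) *
        Complex.exp (-((R * Complex.exp (θ * Complex.I)) * t)) =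
      ((R ^ (-p) * Real.Gamma p : ℝ) : ℂ) * Complex.exp ((-(θ * p) : ℝ) * Complex.I) := by
  have hpi := Real.pi_pos
  rw [integral_rpow_mul_cexp_neg_mul hp, ← Complex.ofReal_neg,
    ofReal_mul_exp_mul_I_cpow hR (by linarith) (by linarith)]
  · rw [mul_neg]
    push_cast
    ring
  · rw [ofReal_mul_exp_mul_I_re]
    exact mul_pos hR (Real.cos_pos_of_mem_Ioo ⟨h1, h2⟩)

theorem exists_rpow_le_add_mul {κ b C : ℝ} (hκ0 : 0 < κ) (hκ1 : κ < 1) (hb : 0 ≤ b) (hC : 0 < C) :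
    ∃ K : ℝ, ∀ r : ℝ, 0 < r → b * r ^ κ ≤ K + C * r := by
  -- Bernoulli's inequality at r/A gives slope b A^{κ-1}, here bC/(b+1) ≤ C; the summand 1 allows b
  -- = 0.
  set A : ℝ := (C / (b + 1)) ^ (κ - 1)⁻¹
  have hA : 0 < A := by positivity
  have hA' : A ^ (κ - 1) = C / (b + 1) :=
    Real.rpow_inv_rpow (by positivity) (by linarith : κ - 1 < 0).ne
  refine ⟨b * A ^ κ, fun r hr => ?_⟩
  have h1 : (r / A) ^ κ ≤ 1 + r / A := by
    have hrA : 0 < r / A := by positivity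
    have h := rpow_one_add_le_one_add_mul_self (s := r / A - 1) (p := κ) (by linarith)
      hκ0.le hκ1.le
    rw [add_sub_cancel] at h
    nlinarith
  have h2 : r ^ κ = A ^ κ * (r / A) ^ κ := by
    rw [← Real.mul_rpow hA.le (by positivity), mul_div_cancel₀ _ hA.ne']
  have h3 : A ^ κ / A = C / (b + 1) := by rw [← hA', Real.rpow_sub_one hA.ne']
  calc b * r ^ κ ≤ b * (A ^ κ * (1 + r / A)) := by
        rw [h2]
        gcongr
    _ = b * A ^ κ + b * (A ^ κ / A) * r := by ring
    _ ≤ b * A ^ κ + C * r := by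
        rw [h3]
        have : b * (C / (b + 1)) ≤ C := by
          rw [mul_div_assoc', div_le_iff₀ (by positivity)]
          nlinarith
        gcongr

theorem integrableOn_rpow_mul_exp_neg_mul_exp_rpow {κ p b C : ℝ} (hκ0 : 0 < κ) (hκ1 : κ < 1)
    (hp : 0 < p) (hb : 0 ≤ b) (hC : 0 < C) :
    IntegrableOn (fun r : ℝ => r ^ (p - 1) * Real.exp (-(C * r)) * Real.exp (b * r ^ κ))
      (Set.Ioi 0) := by
  obtain ⟨K, hK⟩ := exists_rpow_le_add_mul hκ0 hκ1 hb (half_pos hC)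
  refine Integrable.mono' ((integrableOn_rpow_mul_exp_neg hp (half_pos hC)).const_mul (Real.exp K))
    (by fun_prop : Measurable _).aestronglyMeasurable ?_
  filter_upwards [ae_restrict_mem measurableSet_Ioi] with r hr
  have hr0 : (0 : ℝ) < r := hr
  have hle : Real.exp (b * r ^ κ) ≤ Real.exp (K + C / 2 * r) := Real.exp_le_exp.2 (hK r hr0)
  rw [Real.norm_of_nonneg (by positivity)]
  calc r ^ (p - 1) * Real.exp (-(C * r)) * Real.exp (b * r ^ κ)
      ≤ r ^ (p - 1) * Real.exp (-(C * r)) * Real.exp (K + C / 2 * r) := by gcongr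
    _ = r ^ (p - 1) * (Real.exp K * Real.exp (-(C / 2 * r))) := by
        rw [mul_assoc, ← Real.exp_add, ← Real.exp_add]
        ring_nf
    _ = _ := by ring

/-- The kernel `r ^ (κ - 1) exp(-c r) e ^ {iψ}` with `c = -e ^ {iβ}` and `ψ = β κ`. -/
def rotatedKernel (κ β r : ℝ) : ℂ :=
  ((r ^ (κ - 1) : ℝ) : ℂ) * Complex.exp (-(Complex.exp ((β - Real.pi : ℝ) * Complex.I) * r)) *
    Complex.exp ((β * κ : ℝ) * Complex.I)

theorem norm_rotatedKernel (κ β : ℝ) {r : ℝ} (hr : 0 < r) :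
    ‖rotatedKernel κ β r‖ = r ^ (κ - 1) * Real.exp (-(Real.cos (β - Real.pi) * r)) := by
  rw [rotatedKernel, norm_mul, norm_mul, Complex.norm_exp_ofReal_mul_I, mul_one, Complex.norm_real,
    Real.norm_of_nonneg (by positivity), Complex.norm_exp, Complex.neg_re, Complex.re_mul_ofReal,
    Complex.exp_ofReal_mul_I_re]

theorem measurable_rotatedKernel (κ β : ℝ) : Measurable (rotatedKernel κ β) := by
  unfold rotatedKernel
  fun_prop

/-- The remaining phase -βq is the one that a factor e^{iβq} cancels, which is why the final
formulas do not depend on `β`. -/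
theorem integral_rpow_mul_rotatedKernel {κ β q : ℝ} (hβ1 : Real.pi / 2 < β)
    (hβ2 : β < 3 * Real.pi / 2) (hq : 0 < κ + q) :
    ∫ r in Set.Ioi (0 : ℝ), ((r ^ q : ℝ) : ℂ) * rotatedKernel κ β r =
      (Real.Gamma (κ + q) : ℂ) *
        Complex.exp ((Real.pi * (κ + q) - β * q : ℝ) * Complex.I) := by
  have h := integral_rpow_mul_cexp_neg_polar_mul (p := κ + q) (R := 1) (θ := β - Real.pi) hq one_pos
    (by linarith) (by linarith)
  have h1 : ∀ r ∈ Set.Ioi (0 : ℝ), ((r ^ q : ℝ) : ℂ) * rotatedKernel κ β r =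
      Complex.exp ((β * κ : ℝ) * Complex.I) * (((r ^ (κ + q - 1) : ℝ) : ℂ) *
        Complex.exp (-(((1 : ℝ) * Complex.exp ((β - Real.pi : ℝ) * Complex.I)) * r))) := by
    intro r hr
    have hr0 : (0 : ℝ) < r := hr
    have h2 : r ^ (κ + q - 1) = r ^ q * r ^ (κ - 1) := by
      rw [← Real.rpow_add hr0]
      ring_nf
    rw [h2, rotatedKernel, Complex.ofReal_one, one_mul]
    push_cast
    ring
  rw [setIntegral_congr_fun measurableSet_Ioi h1, integral_const_mul, h, Real.one_rpow, one_mul,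
    mul_left_comm, ← Complex.exp_add]
  congr 2
  push_cast
  ring

/-- Γ(x+1) = xΓ(x) at x = κ(j+1) absorbs 1/κ and one factor of (j+1)!, leaving an exponential
series. -/
theorem mittagLefflerDensity_term {κ : ℝ} (hκ : 0 < κ) (u : ℝ) (j : ℕ) :
    1 / (Real.pi * κ) * ((-1) ^ j / (Nat.factorial (j + 1) : ℝ) *
      Real.sin (Real.pi * κ * (j + 1 : ℕ)) * Real.Gamma (κ * (j + 1 : ℕ) + 1) * u ^ j) =
    1 / Real.pi * ((-u) ^ j / (Nat.factorial j : ℝ) *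
      (Real.Gamma (κ + κ * j) * Real.sin (Real.pi * (κ + κ * j)))) := by
  have h1 : κ * ((j + 1 : ℕ) : ℝ) = κ + κ * j := by
    push_cast
    ring
  have h2 : (0 : ℝ) < κ + κ * j := by positivity
  have h3 : (0 : ℝ) < Nat.factorial j := by positivity
  have hpi := Real.pi_pos
  rw [mul_assoc Real.pi, h1, Real.Gamma_add_one h2.ne', Nat.factorial_succ, neg_pow u]
  push_cast
  field_simp
  ring

/-- The Mittag-Leffler density as an integral along a rotated ray. -/
theorem mittagLefflerDensity_eq_integral {κ β : ℝ} (hκ0 : 0 < κ) (hκ1 : κ < 1)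
    (hβ1 : Real.pi / 2 < β) (hβ2 : β < 3 * Real.pi / 2) (u : ℝ) :
    mittagLefflerDensity κ u = 1 / Real.pi * (∫ r in Set.Ioi (0 : ℝ), rotatedKernel κ β r *
      Complex.exp (-(((u * r ^ κ : ℝ) : ℂ) * Complex.exp ((β * κ : ℝ) * Complex.I)))).im := by
  have hC : 0 < Real.cos (β - Real.pi) :=
    Real.cos_pos_of_mem_Ioo ⟨by linarith, by linarith⟩
  set e : ℂ := Complex.exp ((β * κ : ℝ) * Complex.I) with he
  have hen : ‖e‖ = 1 := Complex.norm_exp_ofReal_mul_I _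
  set F : ℕ → ℝ → ℂ := fun j r =>
    rotatedKernel κ β r * ((-(((u * r ^ κ : ℝ) : ℂ) * e)) ^ j / (Nat.factorial j : ℂ)) with hF
  set bound : ℕ → ℝ → ℝ := fun j r => r ^ (κ - 1) * Real.exp (-(Real.cos (β - Real.pi) * r)) *
    ((|u| * r ^ κ) ^ j / (Nat.factorial j : ℝ)) with hbound
  have hboundsum (r : ℝ) : HasSum (fun j => bound j r)
      (r ^ (κ - 1) * Real.exp (-(Real.cos (β - Real.pi) * r)) * Real.exp (|u| * r ^ κ)) := by
    have := NormedSpace.expSeries_div_hasSum_exp (|u| * r ^ κ)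
    rw [← Real.exp_eq_exp_ℝ] at this
    exact this.mul_left _
  have hm := measurable_rotatedKernel κ β
  -- The exponential is expanded in powers of r^κ. The bounds sum to e^{|u| r^κ}, which the decay
  -- e^{-Cr} beats because κ < 1.
  have hsum := hasSum_integral_of_dominated_convergence (μ := volume.restrict (Set.Ioi 0))
    (F := F) (f := fun r => rotatedKernel κ β r *
      Complex.exp (-(((u * r ^ κ : ℝ) : ℂ) * e))) bound
    (fun j => (by fun_prop : Measurable (F j)).aestronglyMeasurable)
    (fun j => by
      filter_upwards [ae_restrict_mem measurableSet_Ioi] with r hr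
      have hr0 : (0 : ℝ) < r := hr
      simp only [hF, hbound]
      rw [norm_mul, norm_rotatedKernel κ β hr0, norm_div, norm_pow, norm_neg, norm_mul, hen,
        Complex.norm_real, mul_one, Complex.norm_natCast, norm_mul, Real.norm_eq_abs,
        Real.norm_of_nonneg (by positivity : 0 ≤ r ^ κ)])
    (.of_forall fun r => (hboundsum r).summable)
    (by
      simp only [fun r => (hboundsum r).tsum_eq]
      exact integrableOn_rpow_mul_exp_neg_mul_exp_rpow hκ0 hκ1 hκ0 (abs_nonneg u) hC)
    (.of_forall fun r => by
      have := NormedSpace.expSeries_div_hasSum_exp (-(((u * r ^ κ : ℝ) : ℂ) * e))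
      rw [← Complex.exp_eq_exp_ℂ] at this
      exact this.mul_left _)
  have hterm (j : ℕ) : ∫ r in Set.Ioi (0 : ℝ), F j r =
      (((-u) ^ j / (Nat.factorial j : ℝ) * Real.Gamma (κ + κ * j) : ℝ) : ℂ) *
        Complex.exp ((Real.pi * (κ + κ * j) : ℝ) * Complex.I) := by
    have h1 : ∀ r ∈ Set.Ioi (0 : ℝ), F j r =
        ((((-u) ^ j / (Nat.factorial j : ℝ) : ℝ) : ℂ) * e ^ j) *
          (((r ^ (κ * j) : ℝ) : ℂ) * rotatedKernel κ β r) := by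
      intro r hr
      have hr0 : (0 : ℝ) < r := hr
      rw [Real.rpow_mul hr0.le, Real.rpow_natCast]
      simp only [hF]
      push_cast
      rw [← neg_mul, ← neg_mul, mul_pow, mul_pow]
      ring
    rw [setIntegral_congr_fun measurableSet_Ioi h1, integral_const_mul,
      integral_rpow_mul_rotatedKernel hβ1 hβ2 (by positivity), he, ← Complex.exp_nat_mul]
    rw [Complex.ofReal_mul (_ / _), mul_mul_mul_comm, ← mul_assoc, ← mul_assoc, mul_assoc _ _
      (Complex.exp _), ← Complex.exp_add]
    congr 2
    push_cast
    ring
  simp only [hterm] at hsum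
  have him := (Complex.hasSum_im hsum).mul_left (1 / Real.pi)
  rw [← him.tsum_eq, mittagLefflerDensity, ← tsum_mul_left]
  congr with j
  rw [mittagLefflerDensity_term hκ0, Complex.im_ofReal_mul, Complex.exp_ofReal_mul_I_im, mul_assoc]

/-- β > π/2 gives decay in r and βκ < π/2 gives decay in u; κ < 1 leaves room for both. -/
theorem exists_rotation_angle {κ : ℝ} (hκ0 : 0 < κ) (hκ1 : κ < 1) :
    ∃ β : ℝ, Real.pi / 2 < β ∧ β < 3 * Real.pi / 2 ∧ 0 < β * κ ∧ β * κ < Real.pi / 2 := by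
  have hpi := Real.pi_pos
  have h : Real.pi / 2 < min (3 * Real.pi / 2) (Real.pi / 2 / κ) := by
    refine lt_min (by linarith) ?_
    rw [lt_div_iff₀ hκ0]
    nlinarith
  obtain ⟨β, h1, h2⟩ := exists_between h
  have h3 := lt_of_lt_of_le h2 (min_le_right _ _)
  rw [lt_div_iff₀ hκ0] at h3
  exact ⟨β, h1, lt_of_lt_of_le h2 (min_le_left _ _), mul_pos (by linarith) hκ0, h3⟩

theorem measurable_mittagLefflerDensity {κ : ℝ} (hκ0 : 0 < κ) (hκ1 : κ < 1) :
    Measurable (mittagLefflerDensity κ) := by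
  obtain ⟨β, hβ1, hβ2, -, -⟩ := exists_rotation_angle hκ0 hκ1
  have hm := measurable_rotatedKernel κ β
  have h : StronglyMeasurable fun u : ℝ => ∫ r in Set.Ioi (0 : ℝ), rotatedKernel κ β r *
      Complex.exp (-(((u * r ^ κ : ℝ) : ℂ) * Complex.exp ((β * κ : ℝ) * Complex.I))) :=
    StronglyMeasurable.integral_prod_right (by fun_prop : Measurable fun p : ℝ × ℝ =>
      rotatedKernel κ β p.2 * Complex.exp (-(((p.1 * p.2 ^ κ : ℝ) : ℂ) *
        Complex.exp ((β * κ : ℝ) * Complex.I)))).stronglyMeasurable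
  have heq : mittagLefflerDensity κ = fun u => 1 / Real.pi *
      (∫ r in Set.Ioi (0 : ℝ), rotatedKernel κ β r * Complex.exp (-(((u * r ^ κ : ℝ) : ℂ) *
        Complex.exp ((β * κ : ℝ) * Complex.I)))).im :=
    funext fun u => mittagLefflerDensity_eq_integral hκ0 hκ1 hβ1 hβ2 u
  rw [heq]
  exact (Complex.measurable_im.comp h.measurable).const_mul _

/-! ### Mellin transform of the density by exchanging two integrals -/

section Mellin

variable {κ β s : ℝ}

/-- The two-variable integrand whose integral over `r` is `u ^ (-s)` times the density. -/
def mellinIntegrand (κ β s u r : ℝ) : ℂ :=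
  ((u ^ (-s) : ℝ) : ℂ) * (rotatedKernel κ β r *
    Complex.exp (-(((u * r ^ κ : ℝ) : ℂ) * Complex.exp ((β * κ : ℝ) * Complex.I))))

theorem norm_mellinIntegrand {u r : ℝ} (hu : 0 < u) (hr : 0 < r) :
    ‖mellinIntegrand κ β s u r‖ = r ^ (κ - 1) * Real.exp (-(Real.cos (β - Real.pi) * r)) *
      (u ^ (1 - s - 1) * Real.exp (-((r ^ κ * Real.cos (β * κ)) * u))) := by
  rw [mellinIntegrand, norm_mul, norm_mul, norm_rotatedKernel κ β hr, Complex.norm_exp,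
    Complex.neg_re, ofReal_mul_exp_mul_I_re, Complex.norm_real,
    Real.norm_of_nonneg (by positivity), sub_sub_cancel_left,
    show u * r ^ κ * Real.cos (β * κ) = r ^ κ * Real.cos (β * κ) * u by ring]
  ring

/-- Integrating the norm over u leaves a constant times r^{κs-1} e^{-Cr}, integrable since κs > 0;
convergence in u at 0 uses s < 1. -/
theorem integrable_mellinIntegrand (hκ0 : 0 < κ) (hβ1 : Real.pi / 2 < β)
    (hβ2 : β < 3 * Real.pi / 2) (hψ0 : 0 < β * κ) (hψ1 : β * κ < Real.pi / 2) (hs0 : 0 < s)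
    (hs1 : s < 1) :
    Integrable (Function.uncurry (mellinIntegrand κ β s))
      ((volume.restrict (Set.Ioi 0)).prod (volume.restrict (Set.Ioi 0))) := by
  have hC : 0 < Real.cos (β - Real.pi) :=
    Real.cos_pos_of_mem_Ioo ⟨by linarith, by linarith⟩
  have hc : 0 < Real.cos (β * κ) := Real.cos_pos_of_mem_Ioo ⟨by linarith, hψ1⟩
  have hs : 0 < 1 - s := by linarith
  have hmeas : Measurable (Function.uncurry (mellinIntegrand κ β s)) := by
    have hm := measurable_rotatedKernel κ β
    unfold Function.uncurry mellinIntegrand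
    fun_prop
  rw [integrable_prod_iff' hmeas.aestronglyMeasurable]
  have hnorm (r : ℝ) (hr : 0 < r) : Set.EqOn (fun u => ‖mellinIntegrand κ β s u r‖)
      (fun u => r ^ (κ - 1) * Real.exp (-(Real.cos (β - Real.pi) * r)) *
      (u ^ (1 - s - 1) * Real.exp (-((r ^ κ * Real.cos (β * κ)) * u)))) (Set.Ioi 0) :=
    fun u hu => norm_mellinIntegrand hu hr
  constructor
  · filter_upwards [ae_restrict_mem measurableSet_Ioi] with r hr
    have hr0 : (0 : ℝ) < r := hr
    refine (integrable_norm_iff (hmeas.comp measurable_prodMk_right).aestronglyMeasurable).1 ?_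
    refine (integrableOn_congr_fun (hnorm r hr) measurableSet_Ioi).2 ?_
    exact (integrableOn_rpow_mul_exp_neg hs (by positivity)).const_mul _
  · have h1 : ∀ r ∈ Set.Ioi (0 : ℝ), ∫ u in Set.Ioi (0 : ℝ), ‖mellinIntegrand κ β s u r‖ =
        Real.Gamma (1 - s) * Real.cos (β * κ) ^ (s - 1) *
          (r ^ (κ * s - 1) * Real.exp (-(Real.cos (β - Real.pi) * r))) := by
      intro r hr
      have hr0 : (0 : ℝ) < r := hr
      rw [setIntegral_congr_fun measurableSet_Ioi (hnorm r hr), integral_const_mul,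
        Real.integral_rpow_mul_exp_neg_mul_Ioi hs (by positivity), one_div,
        Real.inv_rpow (by positivity), ← Real.rpow_neg (by positivity), neg_sub,
        Real.mul_rpow (by positivity) hc.le, ← Real.rpow_mul hr0.le]
      have : r ^ (κ * s - 1) = r ^ (κ - 1) * r ^ (κ * (s - 1)) := by
        rw [← Real.rpow_add hr0]
        ring_nf
      rw [this]
      ring
    refine (integrableOn_congr_fun h1 measurableSet_Ioi).2 ?_
    exact (integrableOn_rpow_mul_exp_neg (by positivity) hC).const_mul _

theorem integral_mellinIntegrand_left (hψ0 : 0 < β * κ) (hψ1 : β * κ < Real.pi / 2)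
    (hs1 : s < 1) {r : ℝ} (hr : 0 < r) :
    ∫ u in Set.Ioi (0 : ℝ), mellinIntegrand κ β s u r =
      (Real.Gamma (1 - s) : ℂ) * Complex.exp ((β * κ * (s - 1) : ℝ) * Complex.I) *
        (((r ^ (κ * (s - 1)) : ℝ) : ℂ) * rotatedKernel κ β r) := by
  have h := integral_rpow_mul_cexp_neg_polar_mul (p := 1 - s) (R := r ^ κ) (θ := β * κ)
    (by linarith) (by positivity) (by linarith) hψ1
  have h1 : ∀ u ∈ Set.Ioi (0 : ℝ), mellinIntegrand κ β s u r = rotatedKernel κ β r *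
      (((u ^ (1 - s - 1) : ℝ) : ℂ) * Complex.exp (-((((r ^ κ : ℝ) : ℂ) *
        Complex.exp ((β * κ : ℝ) * Complex.I)) * u))) := by
    intro u hu
    rw [mellinIntegrand, sub_sub_cancel_left, mul_left_comm]
    congr 4
    push_cast
    ring
  rw [setIntegral_congr_fun measurableSet_Ioi h1, integral_const_mul, h, ← Real.rpow_mul hr.le,
    show κ * -(1 - s) = κ * (s - 1) by ring, show -(β * κ * (1 - s)) = β * κ * (s - 1) by ring]
  push_cast
  ring

/-- Integration over u gives Γ(1-s), then integration over r gives Γ(κs). The phases in `β` cancel.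
-/
theorem integral_integral_mellinIntegrand (hκ0 : 0 < κ) (hβ1 : Real.pi / 2 < β)
    (hβ2 : β < 3 * Real.pi / 2) (hψ0 : 0 < β * κ) (hψ1 : β * κ < Real.pi / 2) (hs0 : 0 < s)
    (hs1 : s < 1) :
    ∫ u in Set.Ioi (0 : ℝ), (∫ r in Set.Ioi (0 : ℝ), mellinIntegrand κ β s u r) =
      ((Real.Gamma (1 - s) * Real.Gamma (κ * s) : ℝ) : ℂ) *
        Complex.exp ((Real.pi * (κ * s) : ℝ) * Complex.I) := by
  rw [integral_integral_swap (integrable_mellinIntegrand hκ0 hβ1 hβ2 hψ0 hψ1 hs0 hs1)]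
  have h1 : ∀ r ∈ Set.Ioi (0 : ℝ), ∫ u in Set.Ioi (0 : ℝ), mellinIntegrand κ β s u r =
      (Real.Gamma (1 - s) : ℂ) * Complex.exp ((β * κ * (s - 1) : ℝ) * Complex.I) *
        (((r ^ (κ * (s - 1)) : ℝ) : ℂ) * rotatedKernel κ β r) :=
    fun r hr => integral_mellinIntegrand_left hψ0 hψ1 hs1 hr
  have hq : κ + κ * (s - 1) = κ * s := by ring
  rw [setIntegral_congr_fun measurableSet_Ioi h1, integral_const_mul,
    integral_rpow_mul_rotatedKernel hβ1 hβ2 (by rw [hq]; positivity), hq, mul_mul_mul_comm,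
    ← Complex.exp_add]
  push_cast
  congr 2
  ring

end Mellin

/-- The Mellin transform of the type 2 Mittag-Leffler density. -/
theorem mellin_mittagLefflerDensity {κ s : ℝ} (hκ0 : 0 < κ) (hκ1 : κ < 1) (hs0 : 0 < s)
    (hs1 : s < 1) :
    IntegrableOn (fun u => u ^ (-s) * mittagLefflerDensity κ u) (Set.Ioi 0) ∧
      ∫ u in Set.Ioi (0 : ℝ), u ^ (-s) * mittagLefflerDensity κ u =
        Real.Gamma (1 - s) / Real.Gamma (1 - κ * s) := by
  obtain ⟨β, hβ1, hβ2, hψ0, hψ1⟩ := exists_rotation_angle hκ0 hκ1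
  have hint := integrable_mellinIntegrand hκ0 hβ1 hβ2 hψ0 hψ1 hs0 hs1
  have hval := integral_integral_mellinIntegrand hκ0 hβ1 hβ2 hψ0 hψ1 hs0 hs1
  have hleft : Integrable (fun u => ∫ r in Set.Ioi (0 : ℝ), mellinIntegrand κ β s u r)
    (volume.restrict (Set.Ioi 0)) := hint.integral_prod_left
  have heq (u : ℝ) : u ^ (-s) * mittagLefflerDensity κ u =
      1 / Real.pi * (∫ r in Set.Ioi (0 : ℝ), mellinIntegrand κ β s u r).im := by
    simp only [mellinIntegrand]
    rw [mittagLefflerDensity_eq_integral hκ0 hκ1 hβ1 hβ2, integral_const_mul,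
      Complex.im_ofReal_mul]
    ring
  simp only [heq]
  refine ⟨hleft.im.const_mul _, ?_⟩
  have him : ∫ u in Set.Ioi (0 : ℝ), (∫ r in Set.Ioi (0 : ℝ), mellinIntegrand κ β s u r).im =
      (∫ u in Set.Ioi (0 : ℝ), (∫ r in Set.Ioi (0 : ℝ), mellinIntegrand κ β s u r)).im :=
    Complex.imCLM.integral_comp_comm hleft
  have hκs : κ * s < 1 := by nlinarith
  have hκs0 : 0 < κ * s := by positivity
  have hG := Real.Gamma_pos_of_pos (by linarith : 0 < 1 - κ * s)
  have hsin : 0 < Real.sin (Real.pi * (κ * s)) :=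
    Real.sin_pos_of_pos_of_lt_pi (by positivity) (by nlinarith [Real.pi_pos])
  -- The reflection formula turns Γ(κs) sin(πκs)/π into 1/Γ(1-κs).
  have hrefl := Real.Gamma_mul_Gamma_one_sub (κ * s)
  rw [integral_const_mul, him, hval, Complex.im_ofReal_mul, Complex.exp_ofReal_mul_I_im]
  rw [eq_div_iff hsin.ne'] at hrefl
  rw [eq_div_iff hG.ne']
  calc _ = 1 / Real.pi * Real.Gamma (1 - s) * (Real.Gamma (κ * s) * Real.Gamma (1 - κ * s) *
      Real.sin (Real.pi * (κ * s))) := by ring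
    _ = _ := by
      rw [hrefl]
      field_simp

/-! ### Mellin uniqueness and identification of the mixing law -/

theorem lintegral_exp_map_log {μ : Measure ℝ} (hμ : ∀ᵐ u ∂μ, 0 < u) (t : ℝ) :
    ∫⁻ x, ENNReal.ofReal (Real.exp (t * x)) ∂(μ.map Real.log) =
      ∫⁻ u, ENNReal.ofReal (u ^ t) ∂μ := by
  rw [lintegral_map (by fun_prop) Real.measurable_log]
  refine lintegral_congr_ae ?_
  filter_upwards [hμ] with u hu
  rw [Real.rpow_def_of_pos hu, mul_comm]

theorem map_exp_map_log {μ : Measure ℝ} (hμ : ∀ᵐ u ∂μ, 0 < u) :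
    (μ.map Real.log).map Real.exp = μ := by
  rw [Measure.map_map Real.measurable_exp Real.measurable_log]
  conv_rhs => rw [← Measure.map_id (μ := μ)]
  refine Measure.map_congr ?_
  filter_upwards [hμ] with u hu
  exact Real.exp_log hu

/-- Laws on `(0, ∞)` are determined by their Mellin transform on a nonempty open interval. -/
theorem MeasureTheory.Measure.ext_of_lintegral_rpow {μ μ' : Measure ℝ} (hμ : ∀ᵐ u ∂μ, 0 < u)
    (hμ' : ∀ᵐ u ∂μ', 0 < u) {a b : ℝ} (hab : a < b)
    (h : ∀ t ∈ Set.Ioo a b, ∫⁻ u, ENNReal.ofReal (u ^ t) ∂μ ≠ ⊤)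
    (heq : ∀ t ∈ Set.Ioo a b, ∫⁻ u, ENNReal.ofReal (u ^ t) ∂μ =
      ∫⁻ u, ENNReal.ofReal (u ^ t) ∂μ') : μ = μ' := by
  rw [← map_exp_map_log hμ, ← map_exp_map_log hμ']
  congr 1
  refine Measure.ext_of_lintegral_exp_eqOn_Ioo hab (fun t ht => ?_) fun t ht => ?_
  · rw [lintegral_exp_map_log hμ]
    exact h t ht
  · rw [lintegral_exp_map_log hμ, lintegral_exp_map_log hμ']
    exact heq t ht

/-- A law on `(0, ∞)` with the Mellin transform of the density `f_κ` has density `f_κ`; in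
particular `f_κ` is nonnegative almost everywhere. -/
theorem eq_mittagLefflerLaw_of_lintegral_rpow {κ : ℝ} (hκ0 : 0 < κ) (hκ1 : κ < 1) {Q : Measure ℝ}
    (hQ : ∀ᵐ u ∂Q, 0 < u)
    (h : ∀ s : ℝ, 0 < s → s < 1 → ∫⁻ u, ENNReal.ofReal (u ^ (-s)) ∂Q =
      ENNReal.ofReal (Real.Gamma (1 - s) / Real.Gamma (1 - κ * s))) :
    Q = mittagLefflerLaw κ := by
  have hf := measurable_mittagLefflerDensity hκ0 hκ1
  set vol : Measure ℝ := volume.restrict (Set.Ioi 0)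
  set Pp : Measure ℝ := vol.withDensity fun u => ENNReal.ofReal (mittagLefflerDensity κ u)
  set Pm : Measure ℝ := vol.withDensity fun u => ENNReal.ofReal (-mittagLefflerDensity κ u)
  have hvol : ∀ᵐ u ∂vol, 0 < u := ae_restrict_mem measurableSet_Ioi
  have hPp : ∀ᵐ u ∂Pp, 0 < u := (withDensity_absolutelyContinuous _ _).ae_le hvol
  have hPm : ∀ᵐ u ∂Pm, 0 < u := (withDensity_absolutelyContinuous _ _).ae_le hvol
  have hlp (g : ℝ → ℝ) (hg : Measurable g) (t : ℝ) :
      ∫⁻ u, ENNReal.ofReal (u ^ t) ∂(vol.withDensity fun u => ENNReal.ofReal (g u)) =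
        ∫⁻ u, ENNReal.ofReal (u ^ t * g u) ∂vol := by
    rw [lintegral_withDensity_eq_lintegral_mul _ (by fun_prop) (by fun_prop)]
    refine lintegral_congr_ae ?_
    filter_upwards [hvol] with u hu
    rw [Pi.mul_apply, mul_comm, ← ENNReal.ofReal_mul (by positivity)]
  -- The density may a priori change sign, so its negative part is moved to the other side and two
  -- positive measures are compared.
  have hsum : Q + Pm = Pp := by
    have hkey : ∀ t ∈ Set.Ioo (-1 : ℝ) 0, ∫⁻ u, ENNReal.ofReal (u ^ t) ∂(Q + Pm) =
        ∫⁻ u, ENNReal.ofReal (u ^ t) ∂Pp ∧ ∫⁻ u, ENNReal.ofReal (u ^ t) ∂Pp ≠ ⊤ := by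
      intro t ht
      obtain ⟨s, rfl⟩ : ∃ s, t = -s := ⟨-t, by simp⟩
      have hs0 : 0 < s := by simpa using ht.2
      have hs1 : s < 1 := by simpa using ht.1
      obtain ⟨hi, hv⟩ := mellin_mittagLefflerDensity hκ0 hκ1 hs0 hs1
      have hκs : 0 < 1 - κ * s := by nlinarith
      have hc : 0 < Real.Gamma (1 - s) / Real.Gamma (1 - κ * s) :=
        div_pos (Real.Gamma_pos_of_pos (by linarith)) (Real.Gamma_pos_of_pos hκs)
      rw [integral_eq_lintegral_pos_part_sub_lintegral_neg_part hi] at hv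
      have hfin1 : ∫⁻ u, ENNReal.ofReal (u ^ (-s) * mittagLefflerDensity κ u) ∂vol ≠ ⊤ :=
        (Integrable.lintegral_lt_top hi).ne
      have hfin2 : ∫⁻ u, ENNReal.ofReal (-(u ^ (-s) * mittagLefflerDensity κ u)) ∂vol ≠ ⊤ :=
        (Integrable.lintegral_lt_top hi.neg).ne
      rw [lintegral_add_measure, h s hs0 hs1, hlp _ hf,
        hlp (fun u => -mittagLefflerDensity κ u) hf.neg]
      simp only [mul_neg]
      refine ⟨?_, hfin1⟩
      rw [← ENNReal.toReal_eq_toReal_iff' (ENNReal.add_ne_top.2 ⟨ENNReal.ofReal_ne_top, hfin2⟩)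
        hfin1, ENNReal.toReal_add ENNReal.ofReal_ne_top hfin2, ENNReal.toReal_ofReal hc.le, ← hv,
        sub_add_cancel]
    refine Measure.ext_of_lintegral_rpow (ae_add_measure_iff.2 ⟨hQ, hPm⟩) hPp
      (by norm_num : (-1 : ℝ) < 0) (fun t ht => ?_) fun t ht => (hkey t ht).1
    rw [(hkey t ht).1]
    exact (hkey t ht).2
  -- `Pm` is dominated by `Pp` yet carried by a disjoint set, so it vanishes.
  have hac : Pm ≪ Pp := by
    rw [← hsum]
    exact Measure.absolutelyContinuous_of_le (Measure.le_add_left le_rfl)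
  have hPm0 : Pm = 0 := by
    have hms : Pp ⟂ₘ Pm := withDensity_ofReal_mutuallySingular hf
    rw [← Measure.MutuallySingular.self_iff]
    exact hms.mono_ac hac Measure.AbsolutelyContinuous.rfl
  rw [hPm0, add_zero] at hsum
  rw [hsum, mittagLefflerLaw, if_neg hκ1.ne]

/-! ### The Normal-Mittag-Leffler law -/

theorem mittagLefflerLaw_laplace {κ : ℝ} (hκ0 : 0 < κ) (hκ1 : κ ≤ 1)
    (hex : ∀ μ : ℝ, 0 < μ → ∃ ρ, IsMittagLefflerType1 μ κ ρ) :
    IsProbabilityMeasure (mittagLefflerLaw κ) ∧ (∀ᵐ u ∂(mittagLefflerLaw κ), 0 ≤ u) ∧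
      ∀ l : ℝ, 0 ≤ l → ∫ u, Real.exp (-(l * u)) ∂(mittagLefflerLaw κ) = mittagLeffler κ (-l) := by
  rcases hκ1.eq_or_lt with rfl | hκ1
  · rw [mittagLefflerLaw, if_pos rfl]
    refine ⟨inferInstance, ?_, fun l _ => ?_⟩
    · rw [ae_dirac_iff measurableSet_Ici]
      exact zero_le_one
    · rw [integral_dirac, mittagLeffler_one, mul_one]
  · obtain ⟨Q, hQ, hQ0, hlap⟩ := exists_laplace_eq_mittagLeffler hκ0 hex
    obtain ⟨ρ, hρ⟩ := hex 1 one_pos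
    have h := eq_mittagLefflerLaw_of_lintegral_rpow hκ0 hκ1
      (ae_pos_of_laplace_eq_mittagLeffler hρ hQ0 hlap) fun s hs0 hs1 =>
        lintegral_rpow_neg_of_laplace_eq_mittagLeffler hκ0 hκ1.le hρ hQ0 hlap hs0 hs1
    rw [← h]
    refine ⟨hQ, hQ0, fun l hl => ?_⟩
    rcases hl.eq_or_lt with rfl | hl
    · simp [mittagLeffler_zero]
    · exact hlap l hl

theorem charFun_gaussianReal_zero_one (t : ℝ) :
    charFun (gaussianReal 0 1) t = (Real.exp (-(t ^ 2 / 2)) : ℂ) := by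
  rw [charFun_gaussianReal]
  push_cast
  congr 1
  simp

theorem measurable_sqrt_mul : Measurable fun p : ℝ × ℝ => √p.1 * p.2 := by fun_prop

/-- Given U = u, √u Z is centred Gaussian of variance u, with characteristic function e^{-s²u/2}. -/
theorem charFun_map_sqrt_mul_prod {U : Measure ℝ} [IsProbabilityMeasure U] (hU : ∀ᵐ u ∂U, 0 ≤ u)
    (s : ℝ) :
    charFun ((U.prod (gaussianReal 0 1)).map fun p => √p.1 * p.2) s =
      ((∫ u, Real.exp (-(s ^ 2 / 2 * u)) ∂U : ℝ) : ℂ) := by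
  rw [charFun_apply_real, integral_map measurable_sqrt_mul.aemeasurable (by fun_prop),
    integral_prod _ (by
      refine Integrable.of_bound (by fun_prop) 1 (.of_forall fun p => ?_)
      rw [← Complex.ofReal_mul, Complex.norm_exp_ofReal_mul_I]), ← integral_complex_ofReal]
  refine integral_congr_ae ?_
  filter_upwards [hU] with u hu
  have h := charFun_gaussianReal_zero_one (s * √u)
  rw [charFun_apply_real, mul_pow, Real.sq_sqrt hu] at h
  rw [show s ^ 2 / 2 * u = s ^ 2 * u / 2 by ring, ← h]
  congr with z
  push_cast
  ring_nf

/-! ### Random sums -/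

theorem charFun_iid_sum {Ω : Type*} [MeasurableSpace Ω] {P : Measure Ω} {w : Measure ℝ}
    {W : ℕ → Ω → ℝ} (hW : ∀ i, HasLaw (W i) w P) (hind : iIndepFun W P) (n : ℕ) (c s : ℝ) :
    charFun (P.map fun ω => c * ∑ i ∈ Finset.range n, W i ω) s = charFun w (c * s) ^ n := by
  rw [charFun_map_mul_comp (Finset.aemeasurable_fun_sum _ fun i _ => (hW i).aemeasurable),
    (hind.restrict _).charFun_map_fun_finsetSum_eq_prod fun i _ => (hW i).aemeasurable]
  simp [fun i => (hW i).map_eq]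

theorem measurable_mul_sum_range (c : ℝ) :
    Measurable fun p : ℕ × (ℕ → ℝ) => c * ∑ i ∈ Finset.range p.1, p.2 i := by
  refine measurable_from_prod_countable_right fun n => ?_
  change Measurable fun x : ℕ → ℝ => c * ∑ i ∈ Finset.range n, x i
  fun_prop

theorem aemeasurable_random_sum {Ω : Type*} [MeasurableSpace Ω] {P : Measure Ω} {N : Ω → ℕ}
    {W : ℕ → Ω → ℝ} (hN : AEMeasurable N P) (hW : ∀ i, AEMeasurable (W i) P) (c : ℝ) :
    AEMeasurable (fun ω => c * ∑ i ∈ Finset.range (N ω), W i ω) P := by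
  exact (measurable_mul_sum_range c).comp_aemeasurable (hN.prodMk (aemeasurable_pi_iff.2 hW))

/-- The characteristic function of a random sum with an independent number of i.i.d. terms. -/
theorem charFun_random_sum {Ω : Type*} [MeasurableSpace Ω] {P : Measure Ω} [IsProbabilityMeasure P]
    {w : Measure ℝ} {N : Ω → ℕ} {W : ℕ → Ω → ℝ} (hN : AEMeasurable N P)
    (hW : ∀ i, HasLaw (W i) w P) (hind : iIndepFun W P)
    (hNW : IndepFun N (fun ω i => W i ω) P) (c s : ℝ) :
    charFun (P.map fun ω => c * ∑ i ∈ Finset.range (N ω), W i ω) s =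
      ∫ n, charFun w (c * s) ^ n ∂(P.map N) := by
  have hWm : AEMeasurable (fun ω i => W i ω) P := aemeasurable_pi_iff.2 fun i => (hW i).aemeasurable
  have hg := measurable_mul_sum_range c
  have := Measure.isProbabilityMeasure_map hN
  have := Measure.isProbabilityMeasure_map hWm
  have hprod := (indepFun_iff_map_prod_eq_prod_map_map hN hWm).1 hNW
  have hmap : (P.map fun ω => c * ∑ i ∈ Finset.range (N ω), W i ω) =
      (((P.map N).prod (P.map fun ω i => W i ω)).map
        fun p : ℕ × (ℕ → ℝ) => c * ∑ i ∈ Finset.range p.1, p.2 i) := by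
    rw [← hprod, AEMeasurable.map_map_of_aemeasurable hg.aemeasurable (hN.prodMk hWm)]
    rfl
  have hm : Measurable fun p : ℕ × (ℕ → ℝ) =>
      Complex.exp (s * ((c * ∑ i ∈ Finset.range p.1, p.2 i : ℝ) : ℂ) * Complex.I) := by
    fun_prop
  rw [hmap, charFun_apply_real, integral_map hg.aemeasurable (by fun_prop), integral_prod _ (by
    refine Integrable.of_bound hm.aestronglyMeasurable 1 (.of_forall fun p => ?_)
    rw [← Complex.ofReal_mul, Complex.norm_exp_ofReal_mul_I])]
  congr with n
  rw [← charFun_iid_sum hW hind n c s, charFun_apply_real,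
    integral_map ((Finset.aemeasurable_fun_sum _ fun i _ => (hW i).aemeasurable).const_mul c)
      (by fun_prop)]
  exact integral_map hWm (hm.comp measurable_prodMk_left).aestronglyMeasurable

theorem norm_pow_sub_pow_le_mul {a b : ℂ} (ha : ‖a‖ ≤ 1) (hb : ‖b‖ ≤ 1) (n : ℕ) :
    ‖a ^ n - b ^ n‖ ≤ n * ‖a - b‖ := by
  induction n with
  | zero => simp
  | succ n ih =>
    have h : a ^ (n + 1) - b ^ (n + 1) = a ^ n * (a - b) + (a ^ n - b ^ n) * b := by ring
    rw [h]
    refine (norm_add_le _ _).trans ?_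
    rw [norm_mul, norm_mul, norm_pow]
    have h1 : ‖a‖ ^ n * ‖a - b‖ ≤ 1 * ‖a - b‖ := by
      gcongr
      exact pow_le_one₀ (norm_nonneg _) ha
    have h2 : ‖a ^ n - b ^ n‖ * ‖b‖ ≤ n * ‖a - b‖ * 1 := by gcongr
    push_cast
    linarith

/-- From 1 - e^{-x} ≥ x/(1+x): for x ≤ 2 use 1 + x ≤ 3, for x ≥ 2 use x/(1+x) ≥ 2/3. It replaces a
bound linear in N by one whose mean is a Laplace transform. -/
theorem min_two_le_mul_one_sub_exp {x : ℝ} (hx : 0 ≤ x) :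
    min 2 x ≤ 3 * (1 - Real.exp (-x)) := by
  have h1 : Real.exp (-x) * (1 + x) ≤ 1 := by
    rw [Real.exp_neg, inv_mul_le_iff₀ (Real.exp_pos x), mul_one, add_comm]
    exact Real.add_one_le_exp x
  have hE := Real.exp_pos (-x)
  rcases le_total x 2 with h | h
  · rw [min_eq_right h]
    have : x ≤ (1 - Real.exp (-x)) * (1 + x) := by nlinarith
    have h0 : 0 ≤ 1 - Real.exp (-x) := by nlinarith
    nlinarith
  · rw [min_eq_left h]
    nlinarith

theorem norm_pow_sub_pow_le_one_sub_exp {a b : ℂ} (ha : ‖a‖ ≤ 1) (hb : ‖b‖ ≤ 1) {d : ℝ}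
    (hd : ‖a - b‖ ≤ d) (n : ℕ) : ‖a ^ n - b ^ n‖ ≤ 3 * (1 - Real.exp (-(n * d))) := by
  have hd0 : 0 ≤ d := (norm_nonneg _).trans hd
  refine le_trans (le_min ?_ ?_) (min_two_le_mul_one_sub_exp (by positivity : 0 ≤ n * d))
  · refine (norm_sub_le _ _).trans ?_
    rw [norm_pow, norm_pow]
    have h1 := pow_le_one₀ (n := n) (norm_nonneg a) ha
    have h2 := pow_le_one₀ (n := n) (norm_nonneg b) hb
    linarith
  · exact (norm_pow_sub_pow_le_mul ha hb n).trans (by gcongr)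

/-- Equal first two moments give equal second-order Taylor polynomials at 0. -/
theorem charFun_sub_charFun_gaussianReal_isLittleO {w : Measure ℝ} [IsProbabilityMeasure w]
    (hmean : ∫ x, x ∂w = 0) (hvar : variance id w = 1) :
    (fun t => charFun w t - charFun (gaussianReal 0 1) t) =o[nhds 0] fun t : ℝ => t ^ 2 := by
  have h (ρ : Measure ℝ) [IsProbabilityMeasure ρ] (h0 : ∫ x, x ∂ρ = 0)
      (h1 : variance id ρ = 1) :
      (fun t : ℝ => charFun ρ t - (1 - t ^ 2 / 2)) =o[nhds 0] fun t => t ^ 2 := by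
    have hsq : ρ[id ^ 2] = 1 := by
      rw [← h1, variance_of_integral_eq_zero aemeasurable_id (by simpa using h0)]
      rfl
    have := taylor_charFun_two (P := ρ) (X := id) aemeasurable_id (by simpa using h0) hsq
    rwa [Measure.map_id] at this
  refine ((h w hmean hvar).sub (h (gaussianReal 0 1) (by simp) (by simp))).congr_left fun t => ?_
  ring

/-! ### Convergence of the characteristic functions -/

section Limit

variable {ι : Type*} {l : Filter ι} {r : ι → ℝ} {m : ι → Measure ℕ} {κ : ℝ}

theorem IsFractionalPoisson.tendsto_integral_exp (hκ : 0 < κ)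
    (hex : ∀ μ : ℝ, 0 < μ → ∃ ρ, IsMittagLefflerType1 μ κ ρ) (hr0 : ∀ i, 0 < r i)
    (hr : Tendsto r l atTop) (hm : ∀ i, IsFractionalPoisson (r i) κ (m i)) {a : ℝ} (ha : 0 ≤ a) :
    Tendsto (fun i => ∫ n : ℕ, Real.exp (-(a * (n / r i))) ∂(m i)) l
      (nhds (mittagLeffler κ (-a))) := by
  rcases ha.eq_or_lt with rfl | ha
  · have := fun i => (hm i).isProbabilityMeasure
    simpa [mittagLeffler_zero] using tendsto_const_nhds
  · simp only [fun i => (hm i).integral_exp_neg_mul_div hκ (hr0 i) ha hex]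
    exact ((continuous_mittagLeffler hκ).comp continuous_neg).tendsto a |>.comp
      ((tendsto_mul_one_sub_exp_neg_div a).comp hr)

theorem norm_charFun_pow_le_one {w : Measure ℝ} [IsProbabilityMeasure w] (t : ℝ) (n : ℕ) :
    ‖charFun w t ^ n‖ ≤ 1 := by
  rw [norm_pow]
  exact pow_le_one₀ (norm_nonneg _) (norm_charFun_le_one t)

theorem integrable_charFun_pow {w : Measure ℝ} [IsProbabilityMeasure w] {m : Measure ℕ}
    [IsProbabilityMeasure m] (t : ℝ) : Integrable (fun n => charFun w t ^ n) m :=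
  Integrable.of_bound (measurable_from_nat (f := fun n => charFun w t ^ n)).aestronglyMeasurable 1
    (.of_forall fun n => norm_charFun_pow_le_one t n)

theorem integrable_exp_neg_mul_natCast_div {m : Measure ℕ} [IsProbabilityMeasure m] {a b : ℝ}
    (ha : 0 ≤ a) (hb : 0 < b) : Integrable (fun n : ℕ => Real.exp (-(a * (n / b)))) m := by
  refine Integrable.of_bound
    (measurable_from_nat (f := fun n : ℕ => Real.exp (-(a * (n / b))))).aestronglyMeasurable 1
    (.of_forall fun n => ?_)
  rw [Real.norm_of_nonneg (Real.exp_pos _).le, Real.exp_le_one_iff]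
  simp only [Left.neg_nonpos_iff]
  positivity

/-- The characteristic functions of normalized fractional Poisson sums converge. -/
theorem IsFractionalPoisson.tendsto_integral_charFun_pow (hκ : 0 < κ)
    (hex : ∀ μ : ℝ, 0 < μ → ∃ ρ, IsMittagLefflerType1 μ κ ρ) (hr0 : ∀ i, 0 < r i)
    (hr : Tendsto r l atTop) (hm : ∀ i, IsFractionalPoisson (r i) κ (m i))
    {w : Measure ℝ} [IsProbabilityMeasure w] (hmean : ∫ x, x ∂w = 0) (hvar : variance id w = 1)
    (s : ℝ) :
    Tendsto (fun i => ∫ n, charFun w (1 / √(r i) * s) ^ n ∂(m i)) l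
      (nhds (mittagLeffler κ (-(s ^ 2 / 2)) : ℂ)) := by
  have := fun i => (hm i).isProbabilityMeasure
  have hsq (i : ι) : (1 / √(r i) * s) ^ 2 = s ^ 2 / r i := by
    rw [mul_pow, div_pow, Real.sq_sqrt (hr0 i).le]
    ring
  -- For Gaussian summands the n-th power is exactly e^{-(s²/2)n/r}, so the scaling limit of N
  -- applies directly.
  have hgauss (i : ι) : ∫ n, charFun (gaussianReal 0 1) (1 / √(r i) * s) ^ n ∂(m i) =
      ((∫ n : ℕ, Real.exp (-(s ^ 2 / 2 * (n / r i))) ∂(m i) : ℝ) : ℂ) := by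
    rw [← integral_complex_ofReal]
    congr with n
    rw [charFun_gaussianReal_zero_one, ← Complex.ofReal_pow, ← Real.exp_nat_mul, hsq]
    congr 2
    ring
  have hB : Tendsto (fun i => ∫ n, charFun (gaussianReal 0 1) (1 / √(r i) * s) ^ n ∂(m i)) l
      (nhds (mittagLeffler κ (-(s ^ 2 / 2)) : ℂ)) := by
    simp only [hgauss]
    exact (Complex.continuous_ofReal.tendsto _).comp
      (tendsto_integral_exp hκ hex hr0 hr hm (by positivity))
  have ht : Tendsto (fun i => 1 / √(r i) * s) l (nhds 0) := by
    have h1 : Tendsto (fun i => (√(r i))⁻¹) l (nhds 0) :=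
      tendsto_inv_atTop_zero.comp (Real.tendsto_sqrt_atTop.comp hr)
    simpa [one_div] using h1.mul_const s
  have hdiff : Tendsto (fun i => ∫ n, charFun w (1 / √(r i) * s) ^ n ∂(m i) -
      ∫ n, charFun (gaussianReal 0 1) (1 / √(r i) * s) ^ n ∂(m i)) l (nhds 0) := by
    rw [Metric.tendsto_nhds]
    intro η hη
    have hE : Continuous fun a : ℝ => 3 * (1 - mittagLeffler κ (-a)) :=
      continuous_const.mul (continuous_const.sub
        ((continuous_mittagLeffler hκ).comp continuous_neg))
    -- ε is fixed before the limit so that the limiting error 3(1 - E_κ(-ε)) is below η.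
    have hsmall : ∀ᶠ a : ℝ in nhdsWithin 0 (Set.Ioi 0), 3 * (1 - mittagLeffler κ (-a)) < η :=
      ((hE.tendsto 0).mono_left nhdsWithin_le_nhds).eventually
        (gt_mem_nhds (by simpa [mittagLeffler_zero] using hη))
    obtain ⟨ε, hε, hε0⟩ := (hsmall.and self_mem_nhdsWithin).exists
    have hε0 : 0 < ε := hε0
    -- Multiplied by (s/√r)² = s²/r, this constant stays below ε/r, also when s = 0.
    have hc : 0 < ε / (s ^ 2 + 1) := by positivity
    have hlo := ht.eventually
      ((charFun_sub_charFun_gaussianReal_isLittleO hmean hvar).bound hc)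
    have hL := (tendsto_integral_exp hκ hex hr0 hr hm hε0.le).const_sub 1 |>.const_mul 3
    filter_upwards [hlo, hL.eventually (gt_mem_nhds hε)] with i h1 h2
    rw [dist_zero_right]
    refine lt_of_le_of_lt ?_ h2
    have hd : ‖charFun w (1 / √(r i) * s) - charFun (gaussianReal 0 1) (1 / √(r i) * s)‖ ≤
        ε / r i := by
      refine h1.trans ?_
      rw [hsq, Real.norm_of_nonneg (by have := hr0 i; positivity)]
      have hri := hr0 i
      rw [div_mul_div_comm, div_le_div_iff₀ (by positivity) hri]
      nlinarith [mul_pos hε0 hri]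
    rw [← integral_sub (integrable_charFun_pow _) (integrable_charFun_pow _)]
    have hi := integrable_exp_neg_mul_natCast_div (m := m i) hε0.le (hr0 i)
    have hval : ∫ n : ℕ, 3 * (1 - Real.exp (-(ε * (n / r i)))) ∂(m i) =
        3 * (1 - ∫ n : ℕ, Real.exp (-(ε * (n / r i))) ∂(m i)) := by
      rw [integral_const_mul, integral_sub (integrable_const 1) hi]
      simp
    rw [← hval]
    refine norm_integral_le_of_norm_le (((integrable_const 1).sub hi).const_mul 3)
      (.of_forall fun n => ?_)
    have h3 := norm_pow_sub_pow_le_one_sub_exp (norm_charFun_le_one (μ := w) (1 / √(r i) * s))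
      (norm_charFun_le_one (μ := gaussianReal 0 1) (1 / √(r i) * s)) hd n
    rwa [show (n : ℝ) * (ε / r i) = ε * (n / r i) by ring] at h3
  simpa using hdiff.add hB

end Limit

end

/-- The sample spaces `Ω ν` and the sequences `W ν` may depend on `ν > 0`; only the common law `w`
of the summands is fixed. A single space with a single sequence is the special case in which they
are constant. -/
theorem proposition1 (κ : ℝ) (hκ0 : 0 < κ) (hκ1 : κ ≤ 1)
    -- the law of the summands: mean `0` and variance `1`
    (w : Measure ℝ) [IsProbabilityMeasure w] (hw : MemLp id 2 w)
    (hw_mean : ∫ x, x ∂w = 0) (hw_var : variance id w = 1)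
    -- for every `ν > 0`, a variable `N ν` with law `FP(ν, κ)` and an i.i.d. sequence independent
    -- of it
    {Ω : Set.Ioi (0 : ℝ) → Type*} [∀ ν, MeasurableSpace (Ω ν)]
    (P : ∀ ν, Measure (Ω ν)) [∀ ν, IsProbabilityMeasure (P ν)]
    (N : ∀ ν, Ω ν → ℕ) (hN : ∀ ν, AEMeasurable (N ν) (P ν))
    (hN_law : ∀ ν : Set.Ioi (0 : ℝ), IsFractionalPoisson ν κ ((P ν).map (N ν)))
    (W : ∀ ν, ℕ → Ω ν → ℝ) (hW_law : ∀ ν i, HasLaw (W ν i) w (P ν))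
    (hW_indep : ∀ ν, iIndepFun (W ν) (P ν))
    (hNW : ∀ ν, IndepFun (N ν) (fun ω i => W ν i ω) (P ν)) :
    ∃ (μ : Measure ℝ) (_ : IsProbabilityMeasure μ),
      -- (i) convergence in distribution as `ν → ∞`, and the characteristic function of the limit
      TendstoInDistribution
        (fun (ν : Set.Ioi (0 : ℝ)) (ω : Ω ν) => (1 / √(ν : ℝ)) * ∑ i ∈ Finset.range (N ν ω), W ν i ω) atTop
        (fun y : ℝ => y) P μ ∧
      (∀ s : ℝ, charFun μ s = (mittagLeffler κ (-(s ^ 2 / 2)) : ℂ)) ∧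
      -- (ii) the limit is the law of `√U * Z`
      IsProbabilityMeasure (mittagLefflerLaw κ) ∧
      μ = normalMittagLefflerLaw κ ∧
      ∀ {Ω' : Type*} [MeasurableSpace Ω'] (P' : Measure Ω') [IsProbabilityMeasure P']
        (U Z : Ω' → ℝ), HasLaw U (mittagLefflerLaw κ) P' → HasLaw Z (gaussianReal 0 1) P' →
        IndepFun U Z P' → HasLaw (fun ω => √(U ω) * Z ω) μ P' := by
  -- The waiting time laws exist because a fractional Poisson variable is given for every rate.
  have hex : ∀ μ : ℝ, 0 < μ → ∃ ρ, IsMittagLefflerType1 μ κ ρ := fun μ hμ =>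
    let ⟨ρ, h, _⟩ := hN_law ⟨μ, hμ⟩
    ⟨ρ, h⟩
  obtain ⟨hprob, hnonneg, hlap⟩ := mittagLefflerLaw_laplace hκ0 hκ1 hex
  have hNML : IsProbabilityMeasure (normalMittagLefflerLaw κ) :=
    Measure.isProbabilityMeasure_map measurable_sqrt_mul.aemeasurable
  have hchar (s : ℝ) : charFun (normalMittagLefflerLaw κ) s =
      (mittagLeffler κ (-(s ^ 2 / 2)) : ℂ) := by
    rw [normalMittagLefflerLaw, charFun_map_sqrt_mul_prod hnonneg, hlap _ (by positivity)]
  have hmeas (ν : Set.Ioi (0 : ℝ)) : AEMeasurable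
      (fun ω => (1 / √(ν : ℝ)) * ∑ i ∈ Finset.range (N ν ω), W ν i ω) (P ν) :=
    aemeasurable_random_sum (hN ν) (fun i => (hW_law ν i).aemeasurable) _
  refine ⟨normalMittagLefflerLaw κ, hNML, ⟨hmeas, by fun_prop, ?_⟩, hchar, hprob, rfl, ?_⟩
  -- Convergence along ν → ∞ is tested on sequences, to which Lévy's theorem is applied.
  · have : (atTop : Filter (Set.Ioi (0 : ℝ))).IsCountablyGenerated := by
      rw [atTop_Ioi_eq]
      infer_instance
    refine tendsto_of_seq_tendsto fun x hx => ?_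
    refine ProbabilityMeasure.tendsto_of_tendsto_charFun fun s => ?_
    have hlim := IsFractionalPoisson.tendsto_integral_charFun_pow hκ0 hex
      (fun n => (x n).2) (tendsto_Ioi_atTop.1 hx) (fun n => hN_law (x n)) hw_mean hw_var s
    change Tendsto (fun n => charFun ((P (x n)).map fun ω =>
      (1 / √(x n : ℝ)) * ∑ i ∈ Finset.range (N (x n) ω), W (x n) i ω) s) atTop
      (nhds (charFun ((normalMittagLefflerLaw κ).map fun y : ℝ => y) s))
    rw [Measure.map_id', hchar]
    simpa only [fun n => charFun_random_sum (hN (x n)) (hW_law (x n)) (hW_indep (x n)) (hNW (x n))]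
      using hlim
  · intro Ω' _ P' _ U Z hU hZ hUZ
    have hpair := hUZ.hasLaw_prod hU hZ
    refine ⟨measurable_sqrt_mul.comp_aemeasurable hpair.aemeasurable, ?_⟩
    rw [normalMittagLefflerLaw, ← hpair.map_eq,
      AEMeasurable.map_map_of_aemeasurable measurable_sqrt_mul.aemeasurable hpair.aemeasurable]
    rfl
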